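/- For integers $m,k\ge 0$ let $S^1$ act on $\mathbb{R}^m\oplus\mathbb{C}^k$ trivially on $\mathbb{R}^m$ and by complex scalar multiplication on $\mathbb{C}^k$, and let $(\mathbb{R}^m\oplus\mathbb{C}^k)^+$ be its one-point compactification, with the induced action fixing $\infty$; its fixed point set is $(\mathbb{R}^m)^+$. **Lemma.** Let $m,n\ge 0$ and $d$ be integers with $n+d\ge 0$, and let $$f:(\mathbb{R}^m\oplus\mathbb{C}^{n+d})^+\to(\mathbb{R}^m\oplus\mathbb{C}^n)^+$$ be a continuous $S^1$-equivariant map such that the induced map $(\mathbb{R}^m)^+\to(\mathbb{R}^m)^+$ on the fixed point sets has (Brouwer) degree $1$. (For $m=0$ the fixed point set is $S^0=\{0,\infty\}$ and the degree is the one on reduced homology, so that degree $1$ means that the induced map is the identity.) Then $d\le 0$. -/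

import Mathlib

open scoped Topology ContDiff

noncomputable section

/-- The standard real vector space `ℝ^m`. -/
abbrev RealSpace (m : ℕ) : Type := EuclideanSpace ℝ (Fin m)

/-- The sphere `(ℝ^m)^+`, the one-point compactification of `ℝ^m`. -/
abbrev RealSphere (m : ℕ) : Type := OnePoint (RealSpace m)

/-- The underlying space of the `S¹`-representation `ℝ^m ⊕ ℂ^k`. -/
abbrev RepSpace (m k : ℕ) : Type := RealSpace m × EuclideanSpace ℂ (Fin k)

/-- The representation sphere `(ℝ^m ⊕ ℂ^k)^+`, the one-point compactification. -/
abbrev RepSphere (m k : ℕ) : Type := OnePoint (RepSpace m k)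

/-- `q ∈ S¹` acts on `ℝ^m ⊕ ℂ^k` by `(x, z) ↦ (x, q z)`. -/
def circleRot {m k : ℕ} (q : Circle) (v : RepSpace m k) : RepSpace m k :=
  (v.1, (q : ℂ) • v.2)

/-- The action of `S¹` on `(ℝ^m ⊕ ℂ^k)^+`: trivial on `ℝ^m`, by complex multiplication on `ℂ^k`,
and fixing the point at infinity. -/
instance repSphereAction (m k : ℕ) : MulAction Circle (RepSphere m k) where
  smul q p := OnePoint.map (circleRot q) p
  one_smul p := by
    change OnePoint.map (circleRot 1) p = p
    induction p using OnePoint.rec with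
    | infty => rfl
    | coe v => simp [circleRot]
  mul_smul q r p := by
    change OnePoint.map (circleRot (q * r)) p =
      OnePoint.map (circleRot q) (OnePoint.map (circleRot r) p)
    induction p using OnePoint.rec with
    | infty => rfl
    | coe v => simp [circleRot, mul_smul]

theorem circle_smul_infty {m k : ℕ} (q : Circle) :
    q • (OnePoint.infty : RepSphere m k) = OnePoint.infty := rfl

theorem circle_smul_coe {m k : ℕ} (q : Circle) (v : RepSpace m k) :
    q • (v : RepSphere m k) = ((circleRot q v : RepSpace m k) : RepSphere m k) := rfl

/-- The inclusion `(ℝ^m)^+ → (ℝ^m ⊕ ℂ^k)^+`, `x ↦ (x, 0)`, `∞ ↦ ∞`. -/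
def realIncl (m k : ℕ) (p : RealSphere m) : RepSphere m k :=
  OnePoint.map (fun x : RealSpace m => ((x, 0) : RepSpace m k)) p

theorem realIncl_continuous (m k : ℕ) : Continuous (realIncl m k) := by
  refine OnePoint.continuous_map (by fun_prop) ?_
  have h : Topology.IsClosedEmbedding (fun x : RealSpace m => ((x, 0) : RepSpace m k)) := by
    refine ⟨Topology.IsEmbedding.of_leftInverse (f := Prod.fst) (fun _ => rfl)
      continuous_fst (by fun_prop), ?_⟩
    have : Set.range (fun x : RealSpace m => ((x, 0) : RepSpace m k)) = {v | v.2 = 0} := by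
      ext ⟨a, b⟩
      simp [eq_comm]
    rw [this]
    exact isClosed_eq continuous_snd continuous_const
  simpa [Filter.coclosedCompact_eq_cocompact] using h.tendsto_cocompact

theorem realIncl_injective (m k : ℕ) : Function.Injective (realIncl m k) :=
  Option.map_injective (fun _ _ h => congrArg Prod.fst h)

theorem realIncl_range (m k : ℕ) :
    Set.range (realIncl m k) = MulAction.fixedPoints Circle (RepSphere m k) := by
  ext p
  constructor
  · rintro ⟨x, rfl⟩ q
    induction x using OnePoint.rec with
    | infty => rfl
    | coe x => simp [realIncl, circle_smul_coe, circleRot]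
  · intro h
    induction p using OnePoint.rec with
    | infty => exact ⟨OnePoint.infty, rfl⟩
    | coe v =>
      refine ⟨(v.1 : RealSpace m), ?_⟩
      have h1 := h (-1)
      rw [circle_smul_coe, OnePoint.coe_eq_coe] at h1
      have h2 : -v.2 = v.2 := by simpa [circleRot] using congrArg Prod.snd h1
      have h3 : v.2 = 0 := by
        ext i
        have h5 : -(v.2 i) = v.2 i := congrArg (fun w : EuclideanSpace ℂ (Fin k) => w i) h2
        exact self_eq_neg.mp h5.symm
      have h4 : v = (v.1, 0) := Prod.ext rfl h3
      rw [h4]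
      rfl

/-- The fixed point set of `S¹` on `(ℝ^m ⊕ ℂ^k)^+` is `(ℝ^m)^+`. -/
def fixedHomeo (m k : ℕ) :
    RealSphere m ≃ₜ MulAction.fixedPoints Circle (RepSphere m k) :=
  Continuous.homeoOfEquivCompactToT2
    (f := (Equiv.ofInjective _ (realIncl_injective m k)).trans
      (Equiv.setCongr (realIncl_range m k)))
    ((realIncl_continuous m k).subtype_mk _)

/-- The map between the fixed point sets that an equivariant map induces. -/
def fixedPointMap {m k l : ℕ} (f : C(RepSphere m k, RepSphere m l))
    (hf : ∀ (q : Circle) (p : RepSphere m k), f (q • p) = q • f p) :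
    C(MulAction.fixedPoints Circle (RepSphere m k),
      MulAction.fixedPoints Circle (RepSphere m l)) where
  toFun p := ⟨f p.1, fun q => by rw [← hf, p.2 q]⟩
  continuous_toFun := by fun_prop

/-- The map between the fixed point sets, as a self-map of `(ℝ^m)^+`. -/
def fixedSphereMap {m k l : ℕ} (f : C(RepSphere m k, RepSphere m l))
    (hf : ∀ (q : Circle) (p : RepSphere m k), f (q • p) = q • f p) :
    C(RealSphere m, RealSphere m) :=
  ((fixedHomeo m l).symm : C(_, _)).comp
    ((fixedPointMap f hf).comp (fixedHomeo m k : C(_, _)))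

/-- The self-map of `(ℝ^m)^+` is `f` under the inclusions of `(ℝ^m)^+` on both sides. -/
theorem realIncl_fixedSphereMap {m k l : ℕ} (f : C(RepSphere m k, RepSphere m l))
    (hf : ∀ (q : Circle) (p : RepSphere m k), f (q • p) = q • f p) (p : RealSphere m) :
    realIncl m l (fixedSphereMap f hf p) = f (realIncl m k p) :=
  congrArg Subtype.val ((fixedHomeo m l).apply_symm_apply (fixedPointMap f hf (fixedHomeo m k p)))

/-- A self-map `g` of `(ℝ^m)^+` read in the chart `ℝ^m`. It is `g` wherever `g` is finite; the value
at the points that `g` sends to `∞` is irrelevant. -/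
def chartMap {m : ℕ} (g : C(RealSphere m, RealSphere m)) (x : RealSpace m) : RealSpace m :=
  OnePoint.elim (g x) 0 id

/-- `y ∈ ℝ^m` is a regular value of `g`: all its preimages are finite points, at which `g` is
smooth with invertible differential. -/
def IsRegularValueOf {m : ℕ} (g : C(RealSphere m, RealSphere m)) (y : RealSpace m) : Prop :=
  g OnePoint.infty ≠ y ∧
    ∀ x : RealSpace m, g x = y →
      ContDiffAt ℝ ∞ (chartMap g) x ∧ (fderiv ℝ (chartMap g) x).det ≠ 0

open Classical in
/-- The Brouwer degree of a continuous self-map of the sphere `(ℝ^m)^+` (with the same orientation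
on both sides) is `a`.

For `m ≥ 1`: after a homotopy, the preimages of some regular value, counted with the signs of the
Jacobian determinants, add up to `a`. For `m = 0` the sphere is `{0, ∞}`, and the degree is the one
on reduced homology: `1` for the identity, `-1` for the swap, `0` for the constant maps. -/
def HasDegree : {m : ℕ} → C(RealSphere m, RealSphere m) → ℤ → Prop
  | 0, g, a =>
      a = (if g ((0 : RealSpace 0) : RealSphere 0) = ((0 : RealSpace 0) : RealSphere 0)
            then 1 else 0) -
          (if g OnePoint.infty = ((0 : RealSpace 0) : RealSphere 0) then 1 else 0)
  | m + 1, g, a =>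
      ∃ g' : C(RealSphere (m + 1), RealSphere (m + 1)), ContinuousMap.Homotopic g g' ∧
        ∃ y : RealSpace (m + 1), IsRegularValueOf g' y ∧
          ∃ s : Finset (RealSpace (m + 1)), (∀ x : RealSpace (m + 1), x ∈ s ↔ g' x = y) ∧
            a = ∑ x ∈ s, (SignType.sign (fderiv ℝ (chartMap g') x).det : ℤ)

end

/-! Suppose `d > 0`, so that the source has more complex coordinates than the target. Coning `f` off
gives a continuous equivariant map `F : X × ℂ^(l+1) → X × ℂ^n`, with `X = ℝ^m × ℝ`, `n ≤ l` and no
zero except the origin. On `X × 0` it is the cone of the map on fixed point sets, whose degree at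
`0` on the unit ball is the Brouwer degree `1`; the extra real line treats `m = 0` on the same
footing. The contradiction is that this degree must also be `0`.

Two facts give the vanishing (`degreeIn_fixed_eq_zero`). Approximate `F` by a smooth equivariant map
and pad the target with zeros up to `ℂ^(l+1)`. The padded map is never a submersion, so its Jacobian
determinant vanishes identically and its degree is `0`. On the other hand, an equivariant self-map
of `X × ℂ^(l+1)` has the same degree as its restriction to `X` (`degreeIn_eq_degreeIn_fixed`).
Indeed it can be deformed to be the identity in the normal directions near `X`. Off `X` the circle
acts freely, so zeros come in circles, and a dimension count (`exists_generic_perturbation`) shows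
that a generic small perturbation `(c, B z)` has none. All remaining zeros lie in the region where
the map is a product with the identity, and `degreeIn_prod` finishes.

The degree itself is built analytically: it is the integral of the pull-back of a bump form of total
mass `1`, after scaling the map so that the frontier is sent outside the support of the bump.
Homotopy invariance comes from the Jacobian determinant being a null Lagrangian
(`integral_det_pderiv_eq_zero`). A local computation at nondegenerate zeros (`degree_eq_sum_sign`)
links this degree with the signed count in `HasDegree`. -/

namespace BrouwerDegree

open MeasureTheory

/-! ### Null Lagrangians: the integral of a Jacobian determinant with one compactly supported
component. -/

section NullLagrangian

variable {ι : Type*} [Fintype ι] [DecidableEq ι]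

/-- The partial derivative in the `j`-th coordinate direction. -/
noncomputable def pderiv (j : ι) (f : (ι → ℝ) → ℝ) (x : ι → ℝ) : ℝ :=
  fderiv ℝ f x (Pi.single j 1)

theorem contDiff_pderiv {f : (ι → ℝ) → ℝ} (hf : ContDiff ℝ ∞ f) (j : ι) :
    ContDiff ℝ ∞ (pderiv j f) := by
  unfold pderiv
  exact (hf.fderiv_right (m := ∞) (by simp)).clm_apply contDiff_const

theorem pderiv_comm {f : (ι → ℝ) → ℝ} (hf : ContDiff ℝ ∞ f) (i j : ι) (x : ι → ℝ) :
    pderiv i (pderiv j f) x = pderiv j (pderiv i f) x := by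
  have h1 : ∀ v w : ι → ℝ, fderiv ℝ (fun y => fderiv ℝ f y v) x w
      = fderiv ℝ (fderiv ℝ f) x w v := by
    intro v w
    have hd : DifferentiableAt ℝ (fderiv ℝ f) x :=
      ((hf.fderiv_right (m := ∞) (by simp)).differentiable (by simp)).differentiableAt
    rw [fderiv_clm_apply hd (by fun_prop)]
    simp
  have hs : IsSymmSndFDerivAt ℝ f x :=
    (hf.contDiffAt).isSymmSndFDerivAt
      (by simpa [minSmoothness_of_isRCLikeNormedField] using
        (WithTop.coe_le_coe.2 le_top : ((2 : ℕ∞) : WithTop ℕ∞) ≤ ((⊤ : ℕ∞) : WithTop ℕ∞)))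
  unfold pderiv
  rw [h1, h1]
  exact hs _ _

/-- Integration by parts in one Leibniz monomial of the determinant: the derivative is moved off `u
i₀`, whose compact support removes boundary terms. Each resulting term carries one second
derivative, ready for cancellation by symmetry. -/
theorem integral_prod_pderiv (u : ι → (ι → ℝ) → ℝ) (hu : ∀ i, ContDiff ℝ ∞ (u i)) (i₀ : ι)
    (hc : HasCompactSupport (u i₀)) (σ : ι → ι) :
    Integrable (fun x => ∏ i, pderiv (σ i) (u i) x) ∧
    (∀ l, Integrable (fun x => u i₀ x * ((∏ i ∈ (Finset.univ.erase i₀).erase l,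
      pderiv (σ i) (u i) x) * pderiv (σ i₀) (pderiv (σ l) (u l)) x))) ∧
    ∫ x, ∏ i, pderiv (σ i) (u i) x =
      - ∑ l ∈ Finset.univ.erase i₀, ∫ x, u i₀ x * ((∏ i ∈ (Finset.univ.erase i₀).erase l,
        pderiv (σ i) (u i) x) * pderiv (σ i₀) (pderiv (σ l) (u l)) x) := by
  have hp : ∀ i j, ContDiff ℝ ∞ (pderiv j (u i)) := fun i j => contDiff_pderiv (hu i) j
  have hpp : ∀ i j l, ContDiff ℝ ∞ (pderiv l (pderiv j (u i))) :=
    fun i j l => contDiff_pderiv (hp i j) l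
  have hP : ∀ s : Finset ι, ContDiff ℝ ∞ (fun x => ∏ i ∈ s, pderiv (σ i) (u i) x) :=
    fun s => contDiff_prod fun i _ => hp i _
  have hcd : HasCompactSupport (pderiv (σ i₀) (u i₀)) := hc.fderiv_apply (𝕜 := ℝ) _
  have hT : ∀ l, Integrable (fun x => u i₀ x * ((∏ i ∈ (Finset.univ.erase i₀).erase l,
      pderiv (σ i) (u i) x) * pderiv (σ i₀) (pderiv (σ l) (u l)) x)) := fun l =>
    ((hu i₀).continuous.mul ((hP _).continuous.mul
      (hpp l _ _).continuous)).integrable_of_hasCompactSupport hc.mul_right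
  have hsplit : ∀ x, ∏ i, pderiv (σ i) (u i) x =
      fderiv ℝ (u i₀) x (Pi.single (σ i₀) 1) *
        ∏ i ∈ Finset.univ.erase i₀, pderiv (σ i) (u i) x := fun x => by
    rw [← Finset.mul_prod_erase _ _ (Finset.mem_univ i₀)]; rfl
  have hder : ∀ x, fderiv ℝ (fun x => ∏ i ∈ Finset.univ.erase i₀, pderiv (σ i) (u i) x) x
      (Pi.single (σ i₀) 1) = ∑ l ∈ Finset.univ.erase i₀,
        ((∏ i ∈ (Finset.univ.erase i₀).erase l,
        pderiv (σ i) (u i) x) * pderiv (σ i₀) (pderiv (σ l) (u l)) x) := fun x => by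
    rw [fderiv_finsetProd (fun i _ => ((hp i _).differentiable (by simp)).differentiableAt)]
    simp [pderiv]
  have hI1 : Integrable (fun x => fderiv ℝ (u i₀) x (Pi.single (σ i₀) 1) *
        ∏ i ∈ Finset.univ.erase i₀, pderiv (σ i) (u i) x) :=
    ((hp i₀ (σ i₀)).continuous.mul (hP _).continuous).integrable_of_hasCompactSupport
      hcd.mul_right
  refine ⟨by simpa only [hsplit] using hI1, hT, ?_⟩
  have key := integral_mul_fderiv_eq_neg_fderiv_mul_of_integrable (μ := volume)
    (f := u i₀) (g := fun x => ∏ i ∈ Finset.univ.erase i₀, pderiv (σ i) (u i) x)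
    (v := Pi.single (σ i₀) 1) hI1
    (by
      simp only [hder, Finset.mul_sum]
      exact integrable_finsetSum _ fun l _ => hT l)
    (((hu i₀).continuous.mul (hP _).continuous).integrable_of_hasCompactSupport hc.mul_right)
    (fun x _ => ((hu i₀).differentiable (by simp)).differentiableAt)
    (fun x _ => ((hP _).differentiable (by simp)).differentiableAt)
  simp only [hsplit]
  rw [← integral_finsetSum _ (fun l _ => hT l), eq_neg_iff_add_eq_zero, add_comm,
    ← eq_neg_iff_add_eq_zero, ← key]
  simp only [hder, Finset.mul_sum]

/-- The Jacobian determinant is a null Lagrangian. -/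
theorem integral_det_pderiv_eq_zero (u : ι → (ι → ℝ) → ℝ) (hu : ∀ i, ContDiff ℝ ∞ (u i)) (i₀ : ι)
    (hc : HasCompactSupport (u i₀)) :
    ∫ x, (Matrix.of fun i j => pderiv j (u i) x).det = 0 := by
  have hdet : ∀ x, (Matrix.of fun i j => pderiv j (u i) x).det =
      ∑ σ : Equiv.Perm ι, ((Equiv.Perm.sign σ : ℤ) : ℝ) * ∏ i, pderiv (σ i) (u i) x := fun x => by
    rw [← Matrix.det_transpose, Matrix.det_apply']
    rfl
  simp only [hdet]
  rw [integral_finsetSum _ (fun (σ : Equiv.Perm ι) _ =>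
    ((integral_prod_pderiv u hu i₀ hc σ).1).const_mul ((Equiv.Perm.sign σ : ℤ) : ℝ))]
  simp only [integral_const_mul, (integral_prod_pderiv u hu i₀ hc _).2.2, Finset.mul_sum, mul_neg,
    Finset.sum_neg_distrib, neg_eq_zero]
  rw [Finset.sum_comm]
  refine Finset.sum_eq_zero fun l hl => ?_
  have hl0 : l ≠ i₀ := Finset.ne_of_mem_erase hl
  -- For fixed `l`, precomposing `σ` with the transposition of `i₀` and `l` only exchanges the order
  -- of the two derivatives of `u l` and flips the sign, so the terms cancel in pairs.
  refine Finset.sum_involution (fun σ _ => σ * Equiv.swap i₀ l) ?_ ?_ (by simp) ?_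
  · intro σ _
    have hsw : Equiv.Perm.sign (σ * Equiv.swap i₀ l) = - Equiv.Perm.sign σ := by
      simp [Equiv.Perm.sign_swap hl0.symm]
    rw [hsw]
    have : ∀ x, (∏ i ∈ (Finset.univ.erase i₀).erase l,
        pderiv ((σ * Equiv.swap i₀ l) i) (u i) x) =
        ∏ i ∈ (Finset.univ.erase i₀).erase l, pderiv (σ i) (u i) x := fun x => by
      refine Finset.prod_congr rfl fun i hi => ?_
      simp only [Finset.mem_erase, Finset.mem_univ, and_true] at hi
      rw [Equiv.Perm.mul_apply, Equiv.swap_apply_of_ne_of_ne hi.2 hi.1]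
    simp only [this]
    simp only [Equiv.Perm.mul_apply, Equiv.swap_apply_left, Equiv.swap_apply_right,
      pderiv_comm (hu l) (σ l) (σ i₀)]
    push_cast
    ring
  · intro σ _ _ h
    have h2 : Equiv.swap i₀ l = 1 := by simpa using h
    exact hl0 (Equiv.swap_eq_one_iff.1 h2).symm
  · intro σ _
    simp [mul_assoc]

end NullLagrangian
-- The bump-form integral and its invariance under homotopy.
section DegreeIntegral

/-- A smooth bump on the line, supported in `[-1, 1]` and of integral `1`. -/
noncomputable def lineBump : ℝ → ℝ :=
  (⟨1 / 2, 1, by norm_num, by norm_num⟩ : ContDiffBump (0 : ℝ)).normed volume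

theorem contDiff_lineBump : ContDiff ℝ ∞ lineBump := ContDiffBump.contDiff_normed _

theorem integral_lineBump : ∫ t, lineBump t = 1 := ContDiffBump.integral_normed _

theorem lineBump_eq_zero {t : ℝ} (ht : 1 ≤ |t|) : lineBump t = 0 := by
  have h := ContDiffBump.support_normed_eq
    (⟨1 / 2, 1, by norm_num, by norm_num⟩ : ContDiffBump (0 : ℝ)) (μ := volume)
  by_contra hne
  have h2 : t ∈ Function.support lineBump := hne
  rw [lineBump, h] at h2
  simp at h2
  linarith

/-- The primitive of `lineBump`. -/
noncomputable def lineStep (t : ℝ) : ℝ := ∫ s in (-1)..t, lineBump s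

theorem hasDerivAt_lineStep (t : ℝ) : HasDerivAt lineStep (lineBump t) t :=
  intervalIntegral.integral_hasDerivAt_right
    (contDiff_lineBump.continuous.intervalIntegrable _ _)
    (contDiff_lineBump.continuous.stronglyMeasurableAtFilter _ _)
    contDiff_lineBump.continuous.continuousAt

theorem contDiff_lineStep : ContDiff ℝ ∞ lineStep := by
  rw [contDiff_infty_iff_deriv]
  refine ⟨fun t => (hasDerivAt_lineStep t).differentiableAt, ?_⟩
  have : deriv lineStep = lineBump := funext fun t => (hasDerivAt_lineStep t).deriv
  rw [this]
  exact contDiff_lineBump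

theorem lineStep_eq {s t : ℝ} (h : (1 < s ∧ 1 < t) ∨ (s < -1 ∧ t < -1)) :
    lineStep s = lineStep t := by
  have hi := fun a b : ℝ => contDiff_lineBump.continuous.intervalIntegrable (μ := volume) a b
  rw [← sub_eq_zero, lineStep, lineStep,
    intervalIntegral.integral_interval_sub_left (hi _ _) (hi _ _)]
  have : Set.EqOn lineBump (fun _ => 0) (Set.uIcc t s) := by
    intro r hr
    apply lineBump_eq_zero
    rw [Set.mem_uIcc] at hr
    rw [le_abs]
    rcases h with h | h
    · left; rcases hr with hr | hr <;> linarith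
    · right; rcases hr with hr | hr <;> linarith
  rw [intervalIntegral.integral_congr this]
  simp

variable {ι : Type*} [Fintype ι]

/-- A smooth bump on `ℝ^ι`, supported in the unit cube. -/
noncomputable def cubeBump (y : ι → ℝ) : ℝ := ∏ i, lineBump (y i)

theorem contDiff_cubeBump : ContDiff ℝ ∞ (cubeBump (ι := ι)) := by
  unfold cubeBump
  exact contDiff_prod fun i _ => contDiff_lineBump.comp (contDiff_apply ℝ ℝ i)

theorem integral_cubeBump : ∫ y : ι → ℝ, cubeBump y = 1 := by
  unfold cubeBump
  rw [integral_fintype_prod_volume_eq_prod (fun _ => lineBump)]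
  simp [integral_lineBump]

theorem cubeBump_eq_zero_of_coord {y : ι → ℝ} (i : ι) (h : 1 ≤ |y i|) : cubeBump y = 0 :=
  Finset.prod_eq_zero (Finset.mem_univ i) (lineBump_eq_zero h)

theorem exists_one_lt_abs {y : ι → ℝ} (h : 1 < ‖y‖) : ∃ i, 1 < |y i| := by
  by_contra! hcon
  exact absurd ((pi_norm_le_iff_of_nonneg zero_le_one).2 hcon) (not_le.2 h)

theorem cubeBump_eq_zero {y : ι → ℝ} (h : 1 < ‖y‖) : cubeBump y = 0 :=
  let ⟨i, hi⟩ := exists_one_lt_abs h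
  cubeBump_eq_zero_of_coord i hi.le

/-- Both points lie strictly beyond a common face of the unit cube. -/
def SameFace (y y' : ι → ℝ) : Prop :=
  ∃ i, (1 < y i ∧ 1 < y' i) ∨ (y i < -1 ∧ y' i < -1)

theorem SameFace.cubeBump_left {y y' : ι → ℝ} (h : SameFace y y') : cubeBump y = 0 := by
  obtain ⟨i, h⟩ := h
  apply cubeBump_eq_zero_of_coord i
  rw [le_abs]
  rcases h with h | h
  · left; linarith
  · right; linarith

theorem SameFace.cubeBump_right {y y' : ι → ℝ} (h : SameFace y y') : cubeBump y' = 0 := by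
  obtain ⟨i, h⟩ := h
  exact SameFace.cubeBump_left (y' := y) ⟨i, by tauto⟩

/-- The integral over `K` of the pull-back by `F` of the bump form. -/
noncomputable def degIntegral (K : Set (ι → ℝ)) (F : (ι → ℝ) → (ι → ℝ)) : ℝ :=
  ∫ x in K, cubeBump (F x) * (fderiv ℝ F x).det

theorem continuous_degIntegrand {F : (ι → ℝ) → (ι → ℝ)} (hF : ContDiff ℝ ∞ F) :
    Continuous fun x => cubeBump (F x) * (fderiv ℝ F x).det :=
  ((contDiff_cubeBump.comp hF).continuous).mul
    (ContinuousLinearMap.continuous_det.comp (hF.continuous_fderiv (by simp)))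

section
variable [DecidableEq ι]

theorem det_fderiv_eq {F : (ι → ℝ) → (ι → ℝ)} {x : ι → ℝ} (hF : DifferentiableAt ℝ F x) :
    (fderiv ℝ F x).det = (Matrix.of fun i j => pderiv j (fun y => F y i) x).det := by
  rw [ContinuousLinearMap.det, ← LinearMap.det_toMatrix']
  congr 1
  ext i j
  rw [LinearMap.toMatrix'_apply, Matrix.of_apply, pderiv]
  have : HasFDerivAt (fun y => F y i)
      ((ContinuousLinearMap.proj i).comp (fderiv ℝ F x)) x :=
    (hasFDerivAt_pi'.1 hF.hasFDerivAt) i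
  rw [this.fderiv]
  simp

/-- The difference of the two pulled-back bump forms is exact, with an explicit primitive: when only
coordinate `i₀` changes, it is the Jacobian determinant of `F` with that coordinate replaced by `w`.
Differentiating `lineStep` gives the two bump forms; differentiating the other bumps gives multiples
of other rows, which the determinant ignores. -/
theorem det_pderiv_update {F F' : (ι → ℝ) → (ι → ℝ)}
    (hF : ContDiff ℝ ∞ F) (hF' : ContDiff ℝ ∞ F') (i₀ : ι)
    (hFF' : ∀ x, ∀ i ≠ i₀, F x i = F' x i) (w : (ι → ℝ) → ℝ) (x : ι → ℝ)
    (hw : w =ᶠ[𝓝 x] fun x => (lineStep (F x i₀) - lineStep (F' x i₀)) *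
      ∏ i ∈ Finset.univ.erase i₀, lineBump (F x i)) :
    (Matrix.of fun i j => pderiv j (Function.update (fun i x => F x i) i₀ w i) x).det =
      cubeBump (F x) * (fderiv ℝ F x).det - cubeBump (F' x) * (fderiv ℝ F' x).det := by
  have hFi : ∀ i, HasFDerivAt (fun y => F y i) (fderiv ℝ (fun y => F y i) x) x := fun i =>
    (((contDiff_pi.1 hF i).differentiable (by simp)).differentiableAt).hasFDerivAt
  have hFi' : ∀ i, HasFDerivAt (fun y => F' y i) (fderiv ℝ (fun y => F' y i) x) x := fun i =>
    (((contDiff_pi.1 hF' i).differentiable (by simp)).differentiableAt).hasFDerivAt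
  have hβ : ∀ i, HasFDerivAt (fun y => lineBump (F y i))
      (deriv lineBump (F x i) • fderiv ℝ (fun y => F y i) x) x := fun i =>
    (((contDiff_lineBump.differentiable (by simp)).differentiableAt).hasDerivAt).comp_hasFDerivAt
      x (hFi i)
  have hP := HasFDerivAt.finsetProd (u := Finset.univ.erase i₀) (fun i _ => hβ i)
  have hS := ((hasDerivAt_lineStep (F x i₀)).comp_hasFDerivAt x (hFi i₀)).sub
    ((hasDerivAt_lineStep (F' x i₀)).comp_hasFDerivAt x (hFi' i₀))
  have hder := (hS.mul hP).congr_of_eventuallyEq hw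
  set M : Matrix ι ι ℝ := Matrix.of fun i j => pderiv j (fun y => F y i) x with hM
  set r : ι → ℝ := fun j => pderiv j (fun y => F' y i₀) x with hr
  -- The coefficients of the other rows. The value `0` at `i₀` is what lets
  -- `Matrix.det_updateRow_sum` discard the whole sum.
  set c : ι → ℝ := fun l => if l = i₀ then 0 else
    (lineStep (F x i₀) - lineStep (F' x i₀)) *
      ((∏ j ∈ (Finset.univ.erase i₀).erase l, lineBump (F x j)) * deriv lineBump (F x l)) with hc
  have hM' : (Matrix.of fun i j => pderiv j (fun y => F' y i) x) = M.updateRow i₀ r := by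
    ext i j
    by_cases h : i = i₀
    · subst h; simp [hr]
    · rw [Matrix.updateRow_ne h]
      simp [hM, fun y => hFF' y i h]
  have hcub : cubeBump (F x) = lineBump (F x i₀) *
      ∏ i ∈ Finset.univ.erase i₀, lineBump (F x i) :=
    (Finset.mul_prod_erase _ _ (Finset.mem_univ i₀)).symm
  have hcub' : cubeBump (F' x) = lineBump (F' x i₀) *
      ∏ i ∈ Finset.univ.erase i₀, lineBump (F x i) := by
    rw [cubeBump, ← Finset.mul_prod_erase _ _ (Finset.mem_univ i₀)]
    congr 1
    exact Finset.prod_congr rfl fun i hi => by rw [hFF' x i (Finset.ne_of_mem_erase hi)]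
  have hU : (Matrix.of fun i j => pderiv j (Function.update (fun i x => F x i) i₀ w i) x) =
      M.updateRow i₀ ((cubeBump (F x) • M i₀ + (- cubeBump (F' x)) • r) + ∑ l, c l • M l) := by
    ext i j
    by_cases h : i = i₀
    · subst h
      simp only [Matrix.of_apply, Function.update_self, Matrix.updateRow_self, Pi.add_apply,
        Pi.smul_apply, Finset.sum_apply, smul_eq_mul]
      rw [pderiv, hder.fderiv, ← Finset.add_sum_erase _ _ (Finset.mem_univ i)]
      have h1 : ∑ l ∈ Finset.univ.erase i, c l * M l j = ∑ l ∈ Finset.univ.erase i,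
          (lineStep (F x i) - lineStep (F' x i)) *
          ((∏ j ∈ (Finset.univ.erase i).erase l, lineBump (F x j)) * deriv lineBump (F x l)) *
            M l j := Finset.sum_congr rfl fun l hl => by
        simp only [hc, if_neg (Finset.ne_of_mem_erase hl)]
      rw [h1, hcub, hcub']
      simp only [hc, if_true, zero_mul, zero_add, hM, hr, Matrix.of_apply, pderiv,
        _root_.add_apply, _root_.smul_apply,
        _root_.sub_apply, _root_.sum_apply, smul_eq_mul, Finset.mul_sum,
        Function.comp, Pi.sub_apply]
      rw [add_comm]
      congr 1
      · ring
      · exact Finset.sum_congr rfl fun l _ => by ring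
    · rw [Matrix.updateRow_ne h]
      simp [hM, Function.update_of_ne h]
  rw [hU, Matrix.det_updateRow_add, Matrix.det_updateRow_add, Matrix.det_updateRow_smul,
    Matrix.det_updateRow_smul, Matrix.det_updateRow_sum, Matrix.updateRow_eq_self, ← hM',
    det_fderiv_eq ((hF.differentiable (by simp)).differentiableAt),
    det_fderiv_eq ((hF'.differentiable (by simp)).differentiableAt)]
  simp only [hc, if_true, smul_eq_mul, zero_mul, ← hM]
  ring

/-- The primitive of `det_pderiv_update` vanishes wherever `SameFace` holds: beyond a face in
direction `i₀` the two values of `lineStep` agree, and beyond any other face a bump factor is zero.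
Being an open condition, this persists near the frontier. -/
theorem degIntegral_eq_of_coord {K : Set (ι → ℝ)} (hK : IsCompact K) {F F' : (ι → ℝ) → (ι → ℝ)}
    (hF : ContDiff ℝ ∞ F) (hF' : ContDiff ℝ ∞ F') (i₀ : ι)
    (hFF' : ∀ x, ∀ i ≠ i₀, F x i = F' x i) (hface : ∀ x ∈ frontier K, SameFace (F x) (F' x)) :
    degIntegral K F = degIntegral K F' := by
  set b : (ι → ℝ) → ℝ := fun x => (lineStep (F x i₀) - lineStep (F' x i₀)) *
      ∏ i ∈ Finset.univ.erase i₀, lineBump (F x i) with hb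
  have hFi : ∀ i, ContDiff ℝ ∞ (fun y => F y i) := contDiff_pi.1 hF
  have hFi' : ∀ i, ContDiff ℝ ∞ (fun y => F' y i) := contDiff_pi.1 hF'
  have hbs : ContDiff ℝ ∞ b :=
    ((contDiff_lineStep.comp (hFi i₀)).sub (contDiff_lineStep.comp (hFi' i₀))).mul
      (contDiff_prod fun i _ => contDiff_lineBump.comp (hFi i))
  have hb0 : ∀ x, SameFace (F x) (F' x) → b x = 0 := by
    rintro x ⟨i, hi⟩
    by_cases h : i = i₀
    · subst h
      simp only [hb, lineStep_eq hi, sub_self, zero_mul]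
    · have : lineBump (F x i) = 0 := by
        apply lineBump_eq_zero
        rw [le_abs]
        rcases hi with hi | hi
        · left; linarith
        · right; linarith
      simp only [hb]
      rw [Finset.prod_eq_zero (Finset.mem_erase.2 ⟨h, Finset.mem_univ i⟩) this, mul_zero]
  -- Since `b` vanishes near the frontier, cutting it off outside `K` keeps it smooth and makes its
  -- support compact, as the null Lagrangian identity requires.
  set w := K.indicator b with hw
  have hnear : ∀ x ∈ frontier K, ∀ᶠ y in 𝓝 x, b y = 0 := by
    intro x hx
    obtain ⟨i, hi⟩ := hface x hx
    have c1 : ContinuousAt (fun y => F y i) x := (hFi i).continuous.continuousAt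
    have c2 : ContinuousAt (fun y => F' y i) x := (hFi' i).continuous.continuousAt
    rcases hi with hi | hi
    · filter_upwards [c1.eventually_const_lt hi.1, c2.eventually_const_lt hi.2] with y h1 h2
      exact hb0 y ⟨i, Or.inl ⟨h1, h2⟩⟩
    · filter_upwards [c1.eventually_lt_const hi.1, c2.eventually_lt_const hi.2] with y h1 h2
      exact hb0 y ⟨i, Or.inr ⟨h1, h2⟩⟩
  have hin : ∀ x ∈ interior K, w =ᶠ[𝓝 x] b := fun x hx => by
    filter_upwards [mem_interior_iff_mem_nhds.1 hx] with y hy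
    exact Set.indicator_of_mem hy _
  have hout : ∀ x, x ∉ interior K → w =ᶠ[𝓝 x] fun _ => 0 := fun x hx => by
    by_cases hxK : x ∈ K
    · have hfr : x ∈ frontier K := by rw [hK.isClosed.frontier_eq]; exact ⟨hxK, hx⟩
      filter_upwards [hnear x hfr] with y hy
      by_cases hyK : y ∈ K
      · rw [hw, Set.indicator_of_mem hyK, hy]
      · exact Set.indicator_of_notMem hyK _
    · filter_upwards [hK.isClosed.isOpen_compl.mem_nhds hxK] with y hy
      exact Set.indicator_of_notMem hy _
  have hws : ContDiff ℝ ∞ w := contDiff_iff_contDiffAt.2 fun x => by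
    by_cases hx : x ∈ interior K
    · exact hbs.contDiffAt.congr_of_eventuallyEq (hin x hx)
    · exact contDiffAt_const.congr_of_eventuallyEq (hout x hx)
  have hwc : HasCompactSupport w := HasCompactSupport.intro hK fun x hx =>
    Set.indicator_of_notMem hx _
  have key := integral_det_pderiv_eq_zero (Function.update (fun i x => F x i) i₀ w)
    (fun i => by
      by_cases h : i = i₀
      · subst h; simpa using hws
      · simpa [Function.update_of_ne h] using hFi i) i₀ (by simpa using hwc)
  have hpt : ∀ x, (Matrix.of fun i j => pderiv j (Function.update (fun i x => F x i) i₀ w i) x).det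
      = K.indicator (fun x => cubeBump (F x) * (fderiv ℝ F x).det
        - cubeBump (F' x) * (fderiv ℝ F' x).det) x := by
    intro x
    by_cases hx : x ∈ interior K
    · rw [Set.indicator_of_mem (interior_subset hx)]
      exact det_pderiv_update hF hF' i₀ hFF' w x (hin x hx)
    · rw [Matrix.det_eq_zero_of_row_eq_zero i₀]
      · by_cases hxK : x ∈ K
        · have hfr : x ∈ frontier K := by rw [hK.isClosed.frontier_eq]; exact ⟨hxK, hx⟩
          rw [Set.indicator_of_mem hxK, (hface x hfr).cubeBump_left,
            (hface x hfr).cubeBump_right]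
          simp
        · rw [Set.indicator_of_notMem hxK]
      · intro j
        simp only [Matrix.of_apply, Function.update_self, pderiv]
        rw [(hout x hx).fderiv_eq]
        simp
  simp only [hpt] at key
  rw [integral_indicator hK.measurableSet, integral_sub
    ((continuous_degIntegrand hF).continuousOn.integrableOn_compact hK)
    ((continuous_degIntegrand hF').continuousOn.integrableOn_compact hK), sub_eq_zero] at key
  exact key

/-- Coordinates are exchanged one at a time. A hybrid takes each coordinate from `F` or `F'`, so it
stays beyond the face that the two share; this is why a common face is required and not just both
norms exceeding `1`. -/
theorem degIntegral_eq_of_sameFace {K : Set (ι → ℝ)} (hK : IsCompact K)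
    {F F' : (ι → ℝ) → (ι → ℝ)} (hF : ContDiff ℝ ∞ F) (hF' : ContDiff ℝ ∞ F')
    (hface : ∀ x ∈ frontier K, SameFace (F x) (F' x)) :
    degIntegral K F = degIntegral K F' := by
  set H : Finset ι → (ι → ℝ) → (ι → ℝ) := fun s x i => if i ∈ s then F' x i else F x i with hH
  have hHs : ∀ s, ContDiff ℝ ∞ (H s) := fun s => contDiff_pi.2 fun i => by
    by_cases h : i ∈ s
    · simpa [hH, h] using contDiff_pi.1 hF' i
    · simpa [hH, h] using contDiff_pi.1 hF i
  have hind : ∀ s : Finset ι, degIntegral K F = degIntegral K (H s) := by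
    intro s
    induction s using Finset.induction_on with
    | empty => simp [hH]
    | insert a s ha ih =>
      rw [ih]
      refine degIntegral_eq_of_coord hK (hHs _) (hHs _) a (fun x i hi => ?_) fun x hx => ?_
      · simp [hH, hi]
      · obtain ⟨i, hi⟩ := hface x hx
        refine ⟨i, ?_⟩
        simp only [hH]
        split_ifs <;> tauto
  rw [hind Finset.univ]
  simp [hH]

end

/-- Being beyond a given face is open, so by compactness of the frontier nearby times satisfy
`SameFace`. The integral is thus locally constant in `t`; no smoothness in `t` is needed. -/
theorem degIntegral_homotopy {K : Set (ι → ℝ)} (hK : IsCompact K)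
    {H : unitInterval → (ι → ℝ) → (ι → ℝ)} (hs : ∀ t, ContDiff ℝ ∞ (H t))
    (hc : Continuous fun p : unitInterval × (ι → ℝ) => H p.1 p.2)
    (h1 : ∀ t, ∀ x ∈ frontier K, 1 < ‖H t x‖) :
    degIntegral K (H 0) = degIntegral K (H 1) := by
  classical
  have hfK : IsCompact (frontier K) := hK.of_isClosed_subset isClosed_frontier
    hK.isClosed.frontier_subset
  have hloc : IsLocallyConstant fun t => degIntegral K (H t) := by
    rw [IsLocallyConstant.iff_eventually_eq]
    intro t₀
    have : ∀ᶠ t in 𝓝 t₀, ∀ x ∈ frontier K, SameFace (H t x) (H t₀ x) := by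
      apply hfK.eventually_forall_of_forall_eventually
      intro x hx
      obtain ⟨i, hi⟩ := exists_one_lt_abs (h1 t₀ x hx)
      have c1 : ContinuousAt (fun p : unitInterval × (ι → ℝ) => H p.1 p.2 i) (t₀, x) :=
        ((continuous_apply i).comp hc).continuousAt
      have c2 : ContinuousAt (fun p : unitInterval × (ι → ℝ) => H t₀ p.2 i) (t₀, x) :=
        ((continuous_apply i).comp ((hs t₀).continuous.comp continuous_snd)).continuousAt
      rcases lt_abs.1 hi with h | h
      · filter_upwards [c1.eventually_const_lt h, c2.eventually_const_lt h] with p h1 h2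
        exact ⟨i, Or.inl ⟨h1, h2⟩⟩
      · have h' : H t₀ x i < -1 := by linarith
        filter_upwards [c1.eventually_lt_const h', c2.eventually_lt_const h'] with p h1 h2
        exact ⟨i, Or.inr ⟨h1, h2⟩⟩
    filter_upwards [this] with t ht
    exact degIntegral_eq_of_sameFace hK (hs t) (hs t₀) ht
  exact hloc.apply_eq_of_preconnectedSpace 0 1

end DegreeIntegral

/-! ### The degree of continuous maps, and its computation at nondegenerate zeros. -/

section ContinuousDegree

variable {ι : Type*} [Fintype ι]

/-- `G` is a smooth approximation of `c • F` on the frontier of `K`. -/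
def Adapted (K : Set (ι → ℝ)) (F : (ι → ℝ) → (ι → ℝ)) (c : ℝ) (G : (ι → ℝ) → (ι → ℝ)) : Prop :=
  0 < c ∧ ContDiff ℝ ∞ G ∧ ∀ x ∈ frontier K, ‖G x - c • F x‖ + 1 < c * ‖F x‖

open Classical in
/-- The Brouwer degree at `0` on `K` of a continuous map without zeros on the frontier of `K`. -/
noncomputable def degree (K : Set (ι → ℝ)) (F : (ι → ℝ) → (ι → ℝ)) : ℝ :=
  if h : ∃ p : ℝ × ((ι → ℝ) → (ι → ℝ)), Adapted K F p.1 p.2 then degIntegral K h.choose.2 else 0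

theorem Adapted.one_lt_norm {K : Set (ι → ℝ)} {F G : (ι → ℝ) → (ι → ℝ)} {c : ℝ}
    (h : Adapted K F c G) {x : ι → ℝ} (hx : x ∈ frontier K) : 1 < ‖G x‖ := by
  have h1 := h.2.2 x hx
  have h2 : ‖c • F x‖ ≤ ‖G x‖ + ‖G x - c • F x‖ := by
    have := norm_sub_le (G x) (G x - c • F x)
    simpa using this
  rw [norm_smul, Real.norm_of_nonneg h.1.le] at h2
  linarith

theorem degIntegral_eq_of_segment {K : Set (ι → ℝ)} (hK : IsCompact K) {G G' : (ι → ℝ) → (ι → ℝ)}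
    (hG : ContDiff ℝ ∞ G) (hG' : ContDiff ℝ ∞ G')
    (h : ∀ x ∈ frontier K, ∀ t ∈ Set.Icc (0 : ℝ) 1, 1 < ‖(1 - t) • G x + t • G' x‖) :
    degIntegral K G = degIntegral K G' := by
  have := degIntegral_homotopy hK (H := fun t x => (1 - (t : ℝ)) • G x + (t : ℝ) • G' x)
    (fun t => by fun_prop)
    (by
      have h1 := hG.continuous
      have h2 := hG'.continuous
      fun_prop) (fun t x hx => h x hx t t.2)
  simpa using this

/-- Independence of the approximation and the scale. First `G` is stretched by `c' / c ≥ 1`, which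
only moves the frontier values outwards. Then the stretched map and `G'` both take values in a ball
about `c' • F x` that misses the unit ball, and balls are convex. -/
theorem degIntegral_eq_of_adapted_of_le {K : Set (ι → ℝ)} (hK : IsCompact K)
    {F G G' : (ι → ℝ) → (ι → ℝ)} {c c' : ℝ} (h : Adapted K F c G) (h' : Adapted K F c' G')
    (hcc : c ≤ c') : degIntegral K G = degIntegral K G' := by
  have hc := h.1
  set l := c' / c with hl
  have hl1 : 1 ≤ l := (one_le_div hc).2 hcc
  have hlc : l * c = c' := div_mul_cancel₀ _ hc.ne'
  have hlG : ContDiff ℝ ∞ (fun x => l • G x) := by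
    have := h.2.1
    fun_prop
  rw [degIntegral_eq_of_segment hK h.2.1 hlG]
  · refine degIntegral_eq_of_segment hK hlG h'.2.1 fun x hx t ht => ?_
    have hb1 : l • G x ∈ Metric.ball (c' • F x) (c' * ‖F x‖ - 1) := by
      have h1 := h.2.2 x hx
      have h2 : l • G x - c' • F x = l • (G x - c • F x) := by
        rw [smul_sub, smul_smul, hlc]
      rw [mem_ball_iff_norm, h2, norm_smul, Real.norm_of_nonneg (by linarith)]
      have h3 : l * (‖G x - c • F x‖ + 1) < l * (c * ‖F x‖) :=
        mul_lt_mul_of_pos_left h1 (by linarith)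
      rw [← mul_assoc, hlc] at h3
      linarith
    have hb2 : G' x ∈ Metric.ball (c' • F x) (c' * ‖F x‖ - 1) := by
      rw [mem_ball_iff_norm]
      linarith [h'.2.2 x hx]
    have hb := (convex_ball (c' • F x) (c' * ‖F x‖ - 1)) hb1 hb2 (sub_nonneg.2 ht.2) ht.1
      (by ring)
    rw [mem_ball_iff_norm] at hb
    have h2 := norm_sub_le ((1 - t) • l • G x + t • G' x)
      ((1 - t) • l • G x + t • G' x - c' • F x)
    rw [sub_sub_cancel, norm_smul, Real.norm_of_nonneg h'.1.le] at h2
    linarith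
  · intro x hx t ht
    rw [smul_smul, ← add_smul, norm_smul]
    have h1 : 1 ≤ 1 - t + t * l := by nlinarith [ht.1]
    rw [Real.norm_of_nonneg (by linarith)]
    have := h.one_lt_norm hx
    nlinarith

theorem degree_eq_degIntegral {K : Set (ι → ℝ)} (hK : IsCompact K)
    {F G : (ι → ℝ) → (ι → ℝ)} {c : ℝ} (h : Adapted K F c G) :
    degree K F = degIntegral K G := by
  have hex : ∃ p : ℝ × ((ι → ℝ) → (ι → ℝ)), Adapted K F p.1 p.2 := ⟨(c, G), h⟩
  rw [degree, dif_pos hex]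
  rcases le_total hex.choose.1 c with hc | hc
  · exact degIntegral_eq_of_adapted_of_le hK hex.choose_spec h hc
  · exact (degIntegral_eq_of_adapted_of_le hK h hex.choose_spec hc).symm

theorem isCompact_frontier {X : Type*} [TopologicalSpace X] [T2Space X] {K : Set X}
    (hK : IsCompact K) : IsCompact (frontier K) :=
  hK.of_isClosed_subset isClosed_frontier hK.isClosed.frontier_subset

theorem exists_adapted {K : Set (ι → ℝ)} (hK : IsCompact K) {F : (ι → ℝ) → (ι → ℝ)}
    (hF : Continuous F) (h0 : ∀ x ∈ frontier K, F x ≠ 0) : ∃ c G, Adapted K F c G := by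
  obtain ⟨m, hm, hmF⟩ := (isCompact_frontier hK).exists_forall_le' hF.norm.continuousOn (a := 0)
    (fun x hx => norm_pos_iff.2 (h0 x hx))
  obtain ⟨G, hG, hGF, -⟩ := (hF.const_smul (2 / m)).exists_contDiff_approx ⊤
    (continuous_const (y := (1 : ℝ))) (fun _ => one_pos)
  -- Scaling by `2 / m` makes the norm at least `2` on the frontier: one unit for the approximation
  -- error, one for the unit cube.
  refine ⟨2 / m, G, by positivity, hG, fun x hx => ?_⟩
  have h1 := hGF x
  rw [dist_eq_norm] at h1
  have h2 : 2 / m * m ≤ 2 / m * ‖F x‖ := mul_le_mul_of_nonneg_left (hmF x hx) (by positivity)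
  rw [div_mul_cancel₀ _ hm.ne'] at h2
  simp only [Pi.smul_apply] at h1
  linarith

theorem degree_homotopy {K : Set (ι → ℝ)} (hK : IsCompact K)
    {H : unitInterval → (ι → ℝ) → (ι → ℝ)}
    (hc : Continuous fun p : unitInterval × (ι → ℝ) => H p.1 p.2)
    (h0 : ∀ t, ∀ x ∈ frontier K, H t x ≠ 0) :
    degree K (H 0) = degree K (H 1) := by
  have hloc : IsLocallyConstant fun t => degree K (H t) := by
    rw [IsLocallyConstant.iff_eventually_eq]
    intro t₀
    have hct : Continuous (H t₀) := hc.comp (continuous_const.prodMk continuous_id)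
    obtain ⟨c, G, hG⟩ := exists_adapted hK hct (h0 t₀)
    have : ∀ᶠ t in 𝓝 t₀, ∀ x ∈ frontier K, ‖G x - c • H t x‖ + 1 < c * ‖H t x‖ := by
      apply (isCompact_frontier hK).eventually_forall_of_forall_eventually
      intro x hx
      have hGc := hG.2.1.continuous
      have c1 : Continuous (fun p : unitInterval × (ι → ℝ) => ‖G p.2 - c • H p.1 p.2‖ + 1) := by
        fun_prop
      have c2 : Continuous (fun p : unitInterval × (ι → ℝ) => c * ‖H p.1 p.2‖) := by
        fun_prop
      exact c1.continuousAt.eventually_lt c2.continuousAt (hG.2.2 x hx)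
    filter_upwards [this] with t ht
    have hG' : Adapted K (H t) c G := ⟨hG.1, hG.2.1, ht⟩
    rw [degree_eq_degIntegral hK hG, degree_eq_degIntegral hK hG']
  exact hloc.apply_eq_of_preconnectedSpace 0 1

theorem degree_eq_of_segment {K : Set (ι → ℝ)} (hK : IsCompact K) {F F' : (ι → ℝ) → (ι → ℝ)}
    (hF : Continuous F) (hF' : Continuous F')
    (h : ∀ x ∈ frontier K, ∀ t ∈ Set.Icc (0 : ℝ) 1, (1 - t) • F x + t • F' x ≠ 0) :
    degree K F = degree K F' := by
  have := degree_homotopy hK (H := fun t x => (1 - (t : ℝ)) • F x + (t : ℝ) • F' x)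
    (by fun_prop) (fun t x hx => h x hx t t.2)
  simpa using this

theorem degree_eq_of_norm_sub_lt {K : Set (ι → ℝ)} (hK : IsCompact K) {F F' : (ι → ℝ) → (ι → ℝ)}
    (hF : Continuous F) (hF' : Continuous F')
    (h : ∀ x ∈ frontier K, ‖F' x - F x‖ < ‖F x‖) :
    degree K F = degree K F' := by
  refine degree_eq_of_segment hK hF hF' fun x hx t ht h0 => ?_
  have h1 : F x = - (t • (F' x - F x)) := by
    rw [eq_neg_iff_add_eq_zero, ← h0, sub_smul, smul_sub, one_smul]
    abel
  have h2 := h x hx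
  have h3 : ‖F x‖ = t * ‖F' x - F x‖ := by
    conv_lhs => rw [h1]
    rw [norm_neg, norm_smul, Real.norm_of_nonneg ht.1]
  nlinarith [norm_nonneg (F' x - F x), ht.2]

theorem degree_of_contDiff {K : Set (ι → ℝ)} (hK : IsCompact K) {G : (ι → ℝ) → (ι → ℝ)}
    (hG : ContDiff ℝ ∞ G) {c : ℝ} (hc : 0 < c) (h : ∀ x ∈ frontier K, 1 < c * ‖G x‖) :
    degree K G = degIntegral K (fun x => c • G x) :=
  degree_eq_degIntegral hK (c := c) ⟨hc, by fun_prop, fun x hx => by simpa using h x hx⟩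

theorem exists_scale {C : Set (ι → ℝ)} (hC : IsCompact C) {G : (ι → ℝ) → (ι → ℝ)}
    (hG : Continuous G) (h0 : ∀ x ∈ C, G x ≠ 0) :
    ∃ c₀ > 0, ∀ c ≥ c₀, ∀ x ∈ C, 1 < c * ‖G x‖ := by
  obtain ⟨m, hm, hmF⟩ := hC.exists_forall_le' hG.norm.continuousOn (a := 0)
    (fun x hx => norm_pos_iff.2 (h0 x hx))
  refine ⟨2 / m, by positivity, fun c hc x hx => ?_⟩
  have h1 : 2 / m * m ≤ c * ‖G x‖ := mul_le_mul hc (hmF x hx) hm.le (le_trans (by positivity) hc)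
  rw [div_mul_cancel₀ _ hm.ne'] at h1
  linarith

theorem fderiv_smul_det {G : (ι → ℝ) → (ι → ℝ)} (hG : ContDiff ℝ ∞ G) (c : ℝ) (x : ι → ℝ) :
    (fderiv ℝ (fun x => c • G x) x).det = c ^ Fintype.card ι * (fderiv ℝ G x).det := by
  have h : fderiv ℝ (fun x => c • G x) x = c • fderiv ℝ G x :=
    fderiv_const_smul ((hG.differentiable (by simp)).differentiableAt) c
  rw [h]
  simp [ContinuousLinearMap.det, LinearMap.det_smul]

theorem degree_eq_zero_of_det {K : Set (ι → ℝ)} (hK : IsCompact K) {G : (ι → ℝ) → (ι → ℝ)}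
    (hG : ContDiff ℝ ∞ G) (h0 : ∀ x ∈ frontier K, G x ≠ 0)
    (hdet : ∀ x, (fderiv ℝ G x).det = 0) : degree K G = 0 := by
  obtain ⟨c, hc, h⟩ := exists_scale (isCompact_frontier hK) hG.continuous h0
  rw [degree_of_contDiff hK hG hc (h c le_rfl), degIntegral]
  simp [fderiv_smul_det hG, hdet]

/-- The change of variables produces the inverse of `|A.det|`, while the form carries `A.det`; only
the sign survives. -/
theorem integral_cubeBump_affine (A : (ι → ℝ) →L[ℝ] (ι → ℝ)) (hA : A.det ≠ 0) (x₀ : ι → ℝ) :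
    ∫ x, cubeBump (A (x - x₀)) * A.det = (SignType.sign A.det : ℝ) := by
  rw [integral_mul_const, integral_sub_right_eq_self (fun x => cubeBump (A x)) x₀]
  have h1 : ∫ x, cubeBump (A x) = ∫ y, cubeBump y ∂(Measure.map A volume) :=
    (integral_map A.continuous.aemeasurable
      contDiff_cubeBump.continuous.aestronglyMeasurable).symm
  have h2 : Measure.map A volume = ENNReal.ofReal |(A.det)⁻¹| • (volume : Measure (ι → ℝ)) :=
    Measure.map_linearMap_addHaar_eq_smul_addHaar volume (f := (A : (ι → ℝ) →ₗ[ℝ] (ι → ℝ))) hA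
  rw [h1, h2, integral_smul_measure, integral_cubeBump, ENNReal.toReal_ofReal (abs_nonneg _)]
  rcases lt_or_gt_of_ne hA with h | h
  · rw [sign_neg h, abs_inv, abs_of_neg h]
    simp [mul_inv_cancel₀ hA, mul_comm]
  · rw [sign_pos h, abs_inv, abs_of_pos h]
    simp [mul_inv_cancel₀ hA, mul_comm]

theorem exists_pos_mul_norm_le {A : (ι → ℝ) →L[ℝ] (ι → ℝ)} (hA : A.det ≠ 0) :
    ∃ κ > 0, ∀ v, κ * ‖v‖ ≤ ‖A v‖ := by
  set e := A.toContinuousLinearEquivOfDetNeZero hA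
  have he : ∀ v, e v = A v := fun v => rfl
  refine ⟨(‖(e.symm : (ι → ℝ) →L[ℝ] (ι → ℝ))‖ + 1)⁻¹, by positivity, fun v => ?_⟩
  rw [inv_mul_le_iff₀ (by positivity), ← he]
  have h := (e.symm : (ι → ℝ) →L[ℝ] (ι → ℝ)).le_opNorm (e v)
  simp only [ContinuousLinearEquiv.coe_coe, ContinuousLinearEquiv.symm_apply_apply] at h
  nlinarith [norm_nonneg (e v)]

theorem eventually_norm_sub_le {F : (ι → ℝ) → (ι → ℝ)} {A : (ι → ℝ) →L[ℝ] (ι → ℝ)} {x₀ : ι → ℝ}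
    (hF : HasFDerivAt F A x₀) (h0 : F x₀ = 0) (hA : A.det ≠ 0) :
    ∀ᶠ x in 𝓝 x₀, ‖F x - A (x - x₀)‖ ≤ 1 / 2 * ‖A (x - x₀)‖ := by
  obtain ⟨κ, hκ, h⟩ := exists_pos_mul_norm_le hA
  filter_upwards [hF.isLittleO.def (c := κ / 2) (by positivity)] with x hx
  rw [h0, sub_zero] at hx
  linarith [h (x - x₀)]

/-- For a large scale `c` the pulled-back bump is supported in the balls where `G` is affine, and
each ball contributes the full integral of an affine pull-back. -/
theorem degree_eq_sum_of_affine {K : Set (ι → ℝ)} (hK : IsCompact K) {G : (ι → ℝ) → (ι → ℝ)}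
    (hG : ContDiff ℝ ∞ G) (S : Finset (ι → ℝ)) {r : ℝ} (hr : 0 < r)
    (hball : ∀ x ∈ S, Metric.ball x r ⊆ interior K)
    (hdisj : ∀ x ∈ S, ∀ y ∈ S, ∀ z ∈ Metric.ball x r, z ∈ Metric.ball y r → x = y)
    (A : (ι → ℝ) → (ι → ℝ) →L[ℝ] (ι → ℝ)) (hA : ∀ x ∈ S, (A x).det ≠ 0)
    (haff : ∀ x ∈ S, ∀ z ∈ Metric.ball x r, G z = A x (z - x))
    (h0 : ∀ z ∈ K, (∀ x ∈ S, z ∉ Metric.ball x r) → G z ≠ 0) :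
    degree K G = ∑ x ∈ S, (SignType.sign (A x).det : ℝ) := by
  have hfr : ∀ z ∈ frontier K, ∀ x ∈ S, z ∉ Metric.ball x r := fun z hz x hx hzx =>
    (hK.isClosed.frontier_eq ▸ hz).2 (hball x hx hzx)
  set C : Set (ι → ℝ) := K \ ⋃ x ∈ S, Metric.ball x r with hC
  have hCc : IsCompact C := hK.diff (isOpen_biUnion fun x _ => Metric.isOpen_ball)
  have hmemC : ∀ z, z ∈ C ↔ z ∈ K ∧ ∀ x ∈ S, z ∉ Metric.ball x r := fun z => by
    simp [hC]
  obtain ⟨c₁, hc₁, h₁⟩ := exists_scale hCc hG.continuous fun z hz =>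
    h0 z ((hmemC z).1 hz).1 ((hmemC z).1 hz).2
  have hex : ∀ x ∈ S, ∀ᶠ c in Filter.atTop, ∀ z, z ∉ Metric.ball x r → 1 < c * ‖A x (z - x)‖ := by
    intro x hx
    obtain ⟨κ, hκ, h⟩ := exists_pos_mul_norm_le (hA x hx)
    filter_upwards [Filter.eventually_gt_atTop (1 / (κ * r))] with c hc z hz
    have h2 : r ≤ ‖z - x‖ := by rwa [mem_ball_iff_norm, not_lt] at hz
    have h3 : κ * r ≤ ‖A x (z - x)‖ := (mul_le_mul_of_nonneg_left h2 hκ.le).trans (h _)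
    rw [div_lt_iff₀ (by positivity)] at hc
    have hc0 : 0 < c := by
      by_contra hneg
      nlinarith [mul_pos hκ hr]
    exact hc.trans_le (mul_le_mul_of_nonneg_left h3 hc0.le)
  obtain ⟨c, hcS, hcc⟩ := (((Filter.eventually_all_finset S).2 hex).and
    (Filter.eventually_ge_atTop c₁)).exists
  have hc0 : 0 < c := lt_of_lt_of_le hc₁ hcc
  rw [degree_of_contDiff hK hG hc0 fun x hx =>
    h₁ c hcc x ((hmemC x).2 ⟨hK.isClosed.frontier_subset hx, hfr x hx⟩)]
  set g : (ι → ℝ) → (ι → ℝ) → ℝ := fun x z => cubeBump ((c • A x) (z - x)) * (c • A x).det with hg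
  have hg0 : ∀ x ∈ S, ∀ z, z ∉ Metric.ball x r → g x z = 0 := fun x hx z hz => by
    simp only [hg]
    rw [cubeBump_eq_zero, zero_mul]
    rw [_root_.smul_apply, norm_smul, Real.norm_of_nonneg hc0.le]
    exact hcS x hx z hz
  have hgc : ∀ x, Continuous (g x) := fun x =>
    (contDiff_cubeBump.continuous.comp (by fun_prop)).mul continuous_const
  have hpt : ∀ z ∈ K, cubeBump (c • G z) * (fderiv ℝ (fun z => c • G z) z).det =
      ∑ x ∈ S, g x z := by
    intro z hz
    by_cases hex : ∃ x ∈ S, z ∈ Metric.ball x r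
    · obtain ⟨x, hx, hzx⟩ := hex
      rw [Finset.sum_eq_single_of_mem x hx fun y hy hyx => hg0 y hy z fun hzy =>
        hyx (hdisj x hx y hy z hzx hzy).symm]
      have hd : HasFDerivAt (fun z => c • G z) (c • A x) z := by
        have h1 : HasFDerivAt (fun z => (c • A x) (z - x)) (c • A x) z :=
          (c • A x).hasFDerivAt.comp z ((hasFDerivAt_id z).sub_const x)
        refine h1.congr_of_eventuallyEq ?_
        filter_upwards [Metric.isOpen_ball.mem_nhds hzx] with y hy
        rw [haff x hx y hy, _root_.smul_apply]
      simp only [hg]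
      rw [hd.fderiv, haff x hx z hzx, _root_.smul_apply]
    · push Not at hex
      rw [Finset.sum_eq_zero fun x hx => hg0 x hx z (hex x hx), cubeBump_eq_zero, zero_mul]
      rw [norm_smul, Real.norm_of_nonneg hc0.le]
      exact h₁ c hcc z ((hmemC z).2 ⟨hz, hex⟩)
  rw [degIntegral, setIntegral_congr_fun hK.measurableSet hpt,
    integral_finsetSum _ fun x _ => (hgc x).continuousOn.integrableOn_compact hK]
  refine Finset.sum_congr rfl fun x hx => ?_
  rw [setIntegral_eq_integral_of_forall_compl_eq_zero fun z hz => hg0 x hx z fun hzx =>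
    hz (interior_subset (hball x hx hzx))]
  have hdet : (c • A x).det = c ^ Fintype.card ι * (A x).det := by
    simp [ContinuousLinearMap.det, LinearMap.det_smul]
  have hpos : 0 < c ^ Fintype.card ι := by positivity
  simp only [hg]
  rw [integral_cubeBump_affine _ (by rw [hdet]; exact mul_ne_zero hpos.ne' (hA x hx)), hdet,
    sign_mul, sign_pos hpos, one_mul]

/-- The degree is the sum of the local degrees at the zeros, if these are nondegenerate. -/
theorem degree_eq_sum_sign {K : Set (ι → ℝ)} (hK : IsCompact K) {F : (ι → ℝ) → (ι → ℝ)}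
    (hF : Continuous F) (S : Finset (ι → ℝ)) (hS : ∀ x ∈ K, F x = 0 → x ∈ S)
    (hS0 : ∀ x ∈ S, F x = 0) (hSK : ∀ x ∈ S, x ∈ interior K)
    (A : (ι → ℝ) → (ι → ℝ) →L[ℝ] (ι → ℝ)) (hA : ∀ x ∈ S, HasFDerivAt F (A x) x)
    (hdet : ∀ x ∈ S, (A x).det ≠ 0) :
    degree K F = ∑ x ∈ S, (SignType.sign (A x).det : ℝ) := by
  have e1 : ∀ x ∈ S, ∀ᶠ r in 𝓝[>] (0 : ℝ), Metric.ball x r ⊆ interior K := fun x hx => by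
    obtain ⟨ε, hε, h⟩ := Metric.isOpen_iff.1 isOpen_interior x (hSK x hx)
    filter_upwards [Ioo_mem_nhdsGT hε] with r hr
    exact (Metric.ball_subset_ball hr.2.le).trans h
  have e2 : ∀ x ∈ S, ∀ᶠ r in 𝓝[>] (0 : ℝ), ∀ z ∈ Metric.ball x r,
      ‖F z - A x (z - x)‖ ≤ 1 / 2 * ‖A x (z - x)‖ := fun x hx => by
    obtain ⟨ε, hε, h⟩ := Metric.eventually_nhds_iff_ball.1
      (eventually_norm_sub_le (hA x hx) (hS0 x hx) (hdet x hx))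
    filter_upwards [Ioo_mem_nhdsGT hε] with r hr z hz
    exact h z (Metric.ball_subset_ball hr.2.le hz)
  have e3 : ∀ x ∈ S, ∀ y ∈ S, ∀ᶠ r in 𝓝[>] (0 : ℝ), ∀ z ∈ Metric.ball x r,
      z ∈ Metric.ball y r → x = y := fun x hx y hy => by
    by_cases hxy : x = y
    · exact Filter.Eventually.of_forall fun r z _ _ => hxy
    · filter_upwards [Ioo_mem_nhdsGT (half_pos (dist_pos.2 hxy))] with r hr z hzx hzy
      have := dist_triangle_left x y z
      rw [Metric.mem_ball] at hzx hzy
      linarith [hr.2]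
  obtain ⟨r, ⟨⟨⟨h1, h2⟩, h3⟩, hr0⟩⟩ := ((((Filter.eventually_all_finset S).2 e1).and
    ((Filter.eventually_all_finset S).2 e2)).and ((Filter.eventually_all_finset S).2
      fun x hx => (Filter.eventually_all_finset S).2 (e3 x hx))).and self_mem_nhdsWithin |>.exists
  replace hr0 : 0 < r := hr0
  set C : Set (ι → ℝ) := K \ ⋃ x ∈ S, Metric.ball x (r / 2) with hC
  have hCc : IsCompact C := hK.diff (isOpen_biUnion fun x _ => Metric.isOpen_ball)
  have hmemC : ∀ z, z ∈ C ↔ z ∈ K ∧ ∀ x ∈ S, z ∉ Metric.ball x (r / 2) := fun z => by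
    simp [hC]
  have hsub : ∀ x : ι → ℝ, Metric.ball x (r / 2) ⊆ Metric.ball x r := fun x =>
    Metric.ball_subset_ball (half_le_self hr0.le)
  obtain ⟨m, hm, hmF⟩ := hCc.exists_forall_le' hF.norm.continuousOn (a := 0) fun z hz => by
    refine norm_pos_iff.2 fun h0 => ?_
    have hz2 := (hmemC z).1 hz
    exact hz2.2 z (hS z hz2.1 h0) (Metric.mem_ball_self (half_pos hr0))
  obtain ⟨G, hG, hGF, -⟩ := hF.exists_contDiff_approx ⊤
    (continuous_const (y := m / 4)) (fun _ => by positivity)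
  have hGF' : ∀ z, ‖G z - F z‖ < m / 4 := fun z => by
    simpa [dist_eq_norm] using hGF z
  set η : (x : ι → ℝ) → ContDiffBump x := fun x => ⟨r / 2, r, by positivity, by linarith⟩ with hη
  -- A smooth approximation spliced with the linearizations: affine on the balls of radius `r / 2`,
  -- equal to `G` outside those of radius `r`.
  set G' : (ι → ℝ) → (ι → ℝ) := fun z => G z + ∑ x ∈ S, (η x z) • (A x (z - x) - G z) with hG'
  have hG's : ContDiff ℝ ∞ G' := by
    refine hG.add (ContDiff.sum fun x _ => ?_)
    have : ContDiff ℝ ∞ (η x) := (η x).contDiff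
    have hs : ContDiff ℝ ∞ fun z => A x (z - x) - G z := by fun_prop
    exact this.smul hs
  have hη0 : ∀ x z, z ∉ Metric.ball x r → η x z = 0 := fun x z hz =>
    (η x).zero_of_le_dist (not_lt.1 (mt Metric.mem_ball.2 hz))
  have hG'ball : ∀ x ∈ S, ∀ z ∈ Metric.ball x r,
      G' z = G z + (η x z) • (A x (z - x) - G z) := fun x hx z hz => by
    simp only [hG']
    rw [Finset.sum_eq_single_of_mem x hx fun y hy hyx => ?_]
    rw [hη0 y z fun hzy => hyx (h3 x hx y hy z hz hzy).symm, zero_smul]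
  have hG'out : ∀ z, (∀ x ∈ S, z ∉ Metric.ball x r) → G' z = G z := fun z hz => by
    simp only [hG']
    rw [Finset.sum_eq_zero fun x hx => by rw [hη0 x z (hz x hx), zero_smul], add_zero]
  have hfr : ∀ z ∈ frontier K, ∀ x ∈ S, z ∉ Metric.ball x r := fun z hz x hx hzx =>
    (hK.isClosed.frontier_eq ▸ hz).2 (h1 x hx hzx)
  have hstep : degree K F = degree K G' := by
    refine degree_eq_of_norm_sub_lt hK hF hG's.continuous fun z hz => ?_
    rw [hG'out z (hfr z hz)]
    have := hmF z ((hmemC z).2 ⟨hK.isClosed.frontier_subset hz,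
      fun x hx hzx => hfr z hz x hx (hsub x hzx)⟩)
    linarith [hGF' z]
  rw [hstep]
  refine degree_eq_sum_of_affine hK hG's S (half_pos hr0)
    (fun x hx => (hsub x).trans (h1 x hx))
    (fun x hx y hy z hzx hzy => h3 x hx y hy z (hsub x hzx) (hsub y hzy)) A hdet ?_ ?_
  · intro x hx z hz
    rw [hG'ball x hx z (hsub x hz), (η x).one_of_mem_closedBall (Metric.ball_subset_closedBall hz)]
    simp
  · intro z hz hzS h0
    have hmz := hmF z ((hmemC z).2 ⟨hz, hzS⟩)
    have hGz := hGF' z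
    by_cases hex : ∃ x ∈ S, z ∈ Metric.ball x r
    · obtain ⟨x, hx, hzx⟩ := hex
      rw [hG'ball x hx z hzx] at h0
      have hlin := h2 x hx z hzx
      set a := A x (z - x) with ha
      have ht1 : η x z ≤ 1 := (η x).le_one
      have ht0 : 0 ≤ η x z := (η x).nonneg
      -- A zero in the transition shell would give `‖a‖ ≤ ‖G z - a‖ < m / 4 + ‖a‖ / 2`, so `‖a‖ < m
      -- / 2` and `‖F z‖ ≤ 3 / 2 * ‖a‖ < m`, against the lower bound `m` there.
      have hA1 : a = - ((1 - η x z) • (G z - a)) := by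
        have : a + (1 - η x z) • (G z - a) = G z + η x z • (a - G z) := by module
        rw [h0] at this
        exact eq_neg_of_add_eq_zero_left this
      have hA2 : ‖a‖ ≤ ‖G z - a‖ := by
        conv_lhs => rw [hA1]
        rw [norm_neg, norm_smul, Real.norm_of_nonneg (by linarith)]
        nlinarith [norm_nonneg (G z - a)]
      have hA3 : ‖G z - a‖ ≤ ‖G z - F z‖ + ‖F z - a‖ := norm_sub_le_norm_sub_add_norm_sub _ _ _
      have hA4 : ‖F z‖ ≤ ‖F z - a‖ + ‖a‖ := by
        have := norm_add_le (F z - a) a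
        rwa [sub_add_cancel] at this
      linarith
    · push Not at hex
      rw [hG'out z hex] at h0
      rw [h0, zero_sub, norm_neg] at hGz
      linarith

end ContinuousDegree

/-! ### Degree of a map that is a product with the identity near its zeros. -/

section Product

variable {α γ : Type*} [Fintype α] [Fintype γ]

/-- The coordinates of a product. -/
noncomputable abbrev sumCoords (α γ : Type*) : (α ⊕ γ → ℝ) ≃L[ℝ] (α → ℝ) × (γ → ℝ) :=
  ContinuousLinearEquiv.sumPiEquivProdPi ℝ α γ (fun _ => ℝ)

/-- At a large scale the integrand is supported over `U`, where both the bump and the Jacobian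
factor. Fubini then splits off the integral for the scaled identity, which is `1`. -/
theorem degree_prod {K₁ : Set (α → ℝ)} {K₂ : Set (γ → ℝ)} (hK₁ : IsCompact K₁)
    (hK₂ : IsCompact K₂) {U : Set (γ → ℝ)} (hU : U ∈ 𝓝 (0 : γ → ℝ)) (hUo : IsOpen U)
    (hUK : U ⊆ K₂)
    {G : (α → ℝ) → (α → ℝ)} (hG : ContDiff ℝ ∞ G) (hG0 : ∀ x ∈ frontier K₁, G x ≠ 0)
    {h : (α ⊕ γ → ℝ) → (α ⊕ γ → ℝ)} (hh : ContDiff ℝ ∞ h)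
    (hU1 : ∀ x, ∀ z ∈ U, h ((sumCoords α γ).symm (x, z)) = (sumCoords α γ).symm (G x, z))
    (hU2 : ∀ x ∈ K₁, ∀ z ∈ K₂, z ∉ U → h ((sumCoords α γ).symm (x, z)) ≠ 0) :
    degree ((sumCoords α γ).symm '' (K₁ ×ˢ K₂)) h = degree K₁ G := by
  set e := sumCoords α γ with he
  set K := e.symm '' (K₁ ×ˢ K₂) with hKdef
  have hK : IsCompact K := (hK₁.prod hK₂).image e.symm.continuous
  have hKe : K = e ⁻¹' (K₁ ×ˢ K₂) := e.symm.image_eq_preimage_symm _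
  have hmemK : ∀ y, y ∈ K ↔ (e y).1 ∈ K₁ ∧ (e y).2 ∈ K₂ := fun y => by rw [hKe]; rfl
  have hy : ∀ y, y = e.symm ((e y).1, (e y).2) := fun y => by simp
  set C := K \ (fun y => (e y).2) ⁻¹' U with hC
  have hCc : IsCompact C := hK.diff (hUo.preimage (by fun_prop))
  have hhC : ∀ y ∈ C, h y ≠ 0 := fun y hyC => by
    rw [hy y]
    exact hU2 _ ((hmemK y).1 hyC.1).1 _ ((hmemK y).1 hyC.1).2 hyC.2
  have hfrK : ∀ y ∈ frontier K, h y ≠ 0 := by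
    intro y hyf
    by_cases hyU : (e y).2 ∈ U
    · have hfr : (e y).1 ∈ frontier K₁ := by
        rw [hK₁.isClosed.frontier_eq]
        rw [hK.isClosed.frontier_eq] at hyf
        refine ⟨((hmemK y).1 hyf.1).1, fun hin => hyf.2 ?_⟩
        rw [mem_interior]
        refine ⟨e ⁻¹' (interior K₁ ×ˢ U), ?_,
          (isOpen_interior.prod hUo).preimage e.continuous, hin, hyU⟩
        rw [hKe]
        exact Set.preimage_mono (Set.prod_mono interior_subset hUK)
      rw [hy y, hU1 _ _ hyU]
      intro h0
      have h1 := e.symm.map_eq_zero_iff.1 h0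
      exact hG0 _ hfr (congrArg Prod.fst h1)
    · exact hhC y ⟨hK.isClosed.frontier_subset hyf, hyU⟩
  obtain ⟨c₁, hc₁, h1⟩ := exists_scale hCc hh.continuous hhC
  obtain ⟨c₂, hc₂, h2⟩ := exists_scale (isCompact_frontier hK) hh.continuous hfrK
  obtain ⟨c₃, hc₃, h3⟩ := exists_scale (isCompact_frontier hK₁) hG.continuous hG0
  obtain ⟨r, hr, hrU⟩ := Metric.mem_nhds_iff.1 hU
  obtain ⟨c, hcm⟩ := Filter.eventually_atTop.1 ((Filter.eventually_ge_atTop c₁).and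
    ((Filter.eventually_ge_atTop c₂).and ((Filter.eventually_ge_atTop c₃).and
      (Filter.eventually_ge_atTop (2 / r)))))
  obtain ⟨hc1, hc2, hc3, hc4⟩ := hcm c le_rfl
  have hc0 : 0 < c := hc₁.trans_le hc1
  rw [degree_of_contDiff hK hh hc0 (h2 c hc2), degree_of_contDiff hK₁ hG hc0 (h3 c hc3)]
  set g : (γ → ℝ) → ℝ := fun z => cubeBump ((c • ContinuousLinearMap.id ℝ (γ → ℝ)) (z - 0)) *
    (c • ContinuousLinearMap.id ℝ (γ → ℝ)).det with hg
  have hdetc : (c • ContinuousLinearMap.id ℝ (γ → ℝ)).det = c ^ Fintype.card γ := by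
    simp [ContinuousLinearMap.det, LinearMap.det_smul]
  have hg1 : ∫ z, g z = 1 := by
    have hp : 0 < c ^ Fintype.card γ := by positivity
    rw [integral_cubeBump_affine _ (by rw [hdetc]; exact hp.ne'), hdetc, sign_pos hp]
    simp
  have hg0 : ∀ z, z ∉ U → g z = 0 := by
    intro z hz
    have : r ≤ ‖z‖ := by
      by_contra hlt
      exact hz (hrU (mem_ball_zero_iff.2 (not_le.1 hlt)))
    simp only [hg]
    rw [cubeBump_eq_zero, zero_mul]
    simp only [sub_zero, _root_.smul_apply, ContinuousLinearMap.id_apply]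
    rw [norm_smul, Real.norm_of_nonneg hc0.le]
    have h5 : 2 / r * r ≤ c * ‖z‖ := mul_le_mul hc4 this hr.le hc0.le
    rw [div_mul_cancel₀ _ hr.ne'] at h5
    linarith
  set f : (α → ℝ) → ℝ := fun x => cubeBump (c • G x) * (fderiv ℝ (fun x => c • G x) x).det with hf
  have hpt : ∀ y ∈ K, cubeBump (c • h y) * (fderiv ℝ (fun y => c • h y) y).det =
      f (e y).1 * g (e y).2 := by
    intro y hyK
    by_cases hyU : (e y).2 ∈ U
    · have hd : HasFDerivAt h ((e.symm : _ →L[ℝ] _).comp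
          (((fderiv ℝ G (e y).1).prodMap (ContinuousLinearMap.id ℝ (γ → ℝ))).comp
            (e : _ →L[ℝ] _))) y := by
        have hGd : HasFDerivAt G (fderiv ℝ G (e y).1) (e y).1 :=
          ((hG.differentiable (by simp)).differentiableAt).hasFDerivAt
        have hPd : HasFDerivAt (Prod.map G id) ((fderiv ℝ G (e y).1).prodMap
            (ContinuousLinearMap.id ℝ (γ → ℝ))) (e y) :=
          HasFDerivAt.prodMap (e y) hGd (hasFDerivAt_id _)
        have := e.symm.hasFDerivAt.comp y
          (hPd.comp y e.hasFDerivAt)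
        refine this.congr_of_eventuallyEq ?_
        filter_upwards [(hUo.preimage (by fun_prop : Continuous fun y => (e y).2)).mem_nhds hyU]
          with w hw
        conv_lhs => rw [hy w, hU1 _ _ hw]
        rfl
      have hdet : (fderiv ℝ h y).det = (fderiv ℝ G (e y).1).det := by
        rw [hd.fderiv]
        have := LinearMap.det_conj ((fderiv ℝ G (e y).1 : (α → ℝ) →ₗ[ℝ] (α → ℝ)).prodMap
          (LinearMap.id (R := ℝ) (M := γ → ℝ))) e.symm.toLinearEquiv
        rw [LinearMap.det_prodMap, LinearMap.det_id, mul_one] at this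
        exact this
      have hcub : cubeBump (c • h y) = cubeBump (c • G (e y).1) * cubeBump (c • (e y).2) := by
        conv_lhs => rw [hy y, hU1 _ _ hyU]
        rw [cubeBump, Fintype.prod_sum_type]
        rfl
      rw [fderiv_smul_det hh, hdet, hcub]
      simp only [hf, hg]
      rw [fderiv_smul_det hG, hdetc, Fintype.card_sum, pow_add]
      simp only [sub_zero, _root_.smul_apply, ContinuousLinearMap.id_apply]
      ring
    · rw [hg0 _ hyU, mul_zero, cubeBump_eq_zero, zero_mul]
      rw [norm_smul, Real.norm_of_nonneg hc0.le]
      exact h1 c hc1 y ⟨hyK, hyU⟩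
  rw [degIntegral, setIntegral_congr_fun hK.measurableSet hpt, hKe]
  have hmp := (volume_measurePreserving_sumPiEquivProdPi
    (fun _ : α ⊕ γ => ℝ)).setIntegral_preimage_emb
      (MeasurableEquiv.measurableEmbedding _) (fun p => f p.1 * g p.2) (K₁ ×ˢ K₂)
  refine hmp.trans ?_
  rw [Measure.volume_eq_prod, setIntegral_prod_mul,
    setIntegral_eq_integral_of_forall_compl_eq_zero (f := g) fun z hz => hg0 z fun hzU =>
      hz (hUK hzU), hg1, mul_one]
  rfl

end Product

/-! ### Transport of the degree to finite-dimensional spaces with linear coordinates. -/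

section Abstract

variable {ι : Type*} [Fintype ι] {E : Type*} [NormedAddCommGroup E] [NormedSpace ℝ E]

/-- The degree of a map of `E`, in linear coordinates `L`. -/
noncomputable def degreeIn (L : E ≃L[ℝ] (ι → ℝ)) (K : Set E) (F : E → E) : ℝ :=
  degree (L '' K) (fun y => L (F (L.symm y)))

variable (L : E ≃L[ℝ] (ι → ℝ)) {K : Set E}

omit [Fintype ι] in
theorem mem_frontier_image {y : ι → ℝ} (h : y ∈ frontier (L '' K)) : L.symm y ∈ frontier K := by
  have h2 := L.toHomeomorph.image_frontier K
  have h3 : y ∈ L '' frontier K := by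
    rw [show (L '' K) = L.toHomeomorph '' K from rfl, ← h2] at h
    exact h
  obtain ⟨x, hx, rfl⟩ := h3
  simpa using hx

theorem degreeIn_homotopy (hK : IsCompact K) {H : unitInterval → E → E}
    (hc : Continuous fun p : unitInterval × E => H p.1 p.2)
    (h0 : ∀ t, ∀ x ∈ frontier K, H t x ≠ 0) :
    degreeIn L K (H 0) = degreeIn L K (H 1) := by
  refine degree_homotopy (H := fun t y => L (H t (L.symm y))) (hK.image L.continuous) ?_ ?_
  · exact L.continuous.comp (hc.comp (by fun_prop :
      Continuous fun p : unitInterval × (ι → ℝ) => (p.1, L.symm p.2)))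
  · intro t y hy
    rw [Ne, L.map_eq_zero_iff]
    exact h0 t _ (mem_frontier_image L hy)

theorem degreeIn_eq_of_segment (hK : IsCompact K) {F F' : E → E}
    (hF : Continuous F) (hF' : Continuous F')
    (h : ∀ x ∈ frontier K, ∀ t ∈ Set.Icc (0 : ℝ) 1, (1 - t) • F x + t • F' x ≠ 0) :
    degreeIn L K F = degreeIn L K F' := by
  have := degreeIn_homotopy L hK (H := fun t x => (1 - (t : ℝ)) • F x + (t : ℝ) • F' x)
    (by fun_prop) (fun t x hx => h x hx t t.2)
  simpa using this

theorem degreeIn_eq_of_norm_sub_lt (hK : IsCompact K) {F F' : E → E}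
    (hF : Continuous F) (hF' : Continuous F') (h : ∀ x ∈ frontier K, ‖F' x - F x‖ < ‖F x‖) :
    degreeIn L K F = degreeIn L K F' := by
  refine degreeIn_eq_of_segment L hK hF hF' fun x hx t ht h0 => ?_
  have h1 : F x = - (t • (F' x - F x)) := by
    rw [eq_neg_iff_add_eq_zero, ← h0]
    module
  have h2 := h x hx
  have h3 : ‖F x‖ = t * ‖F' x - F x‖ := by
    conv_lhs => rw [h1]
    rw [norm_neg, norm_smul, Real.norm_of_nonneg ht.1]
  nlinarith [norm_nonneg (F' x - F x), ht.2]

omit [Fintype ι] in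
theorem det_conj_coords (A : E →L[ℝ] E) :
    ((L : E →L[ℝ] (ι → ℝ)).comp (A.comp (L.symm : (ι → ℝ) →L[ℝ] E))).det = A.det :=
  LinearMap.det_conj (A : E →ₗ[ℝ] E) L.toLinearEquiv

theorem degreeIn_eq_zero_of_det (hK : IsCompact K) {F : E → E} (hF : ContDiff ℝ ∞ F)
    (h0 : ∀ x ∈ frontier K, F x ≠ 0) (hdet : ∀ x, (fderiv ℝ F x).det = 0) :
    degreeIn L K F = 0 := by
  refine degree_eq_zero_of_det (hK.image L.continuous)
    (L.contDiff.comp (hF.comp L.symm.contDiff)) ?_ ?_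
  · intro y hy
    rw [Ne, L.map_eq_zero_iff]
    exact h0 _ (mem_frontier_image L hy)
  · intro y
    have hd : HasFDerivAt (fun y => L (F (L.symm y))) ((L : E →L[ℝ] (ι → ℝ)).comp
        ((fderiv ℝ F (L.symm y)).comp (L.symm : (ι → ℝ) →L[ℝ] E))) y :=
      (L : E →L[ℝ] (ι → ℝ)).hasFDerivAt.comp y
        (((hF.differentiable (by simp)).differentiableAt).hasFDerivAt.comp y
          (L.symm : (ι → ℝ) →L[ℝ] E).hasFDerivAt)
    rw [hd.fderiv, det_conj_coords, hdet]

theorem degreeIn_eq_sum_sign (hK : IsCompact K) {F : E → E}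
    (hF : Continuous F) (S : Finset E) (hS : ∀ x ∈ K, F x = 0 → x ∈ S)
    (hS0 : ∀ x ∈ S, F x = 0) (hSK : ∀ x ∈ S, x ∈ interior K)
    (A : E → E →L[ℝ] E) (hA : ∀ x ∈ S, HasFDerivAt F (A x) x)
    (hdet : ∀ x ∈ S, (A x).det ≠ 0) :
    degreeIn L K F = ∑ x ∈ S, (SignType.sign (A x).det : ℝ) := by
  have hmap : ∀ y ∈ S.map L.toEquiv.toEmbedding, ∃ x ∈ S, y = L x := fun y hy => by
    obtain ⟨x, hx, rfl⟩ := Finset.mem_map.1 hy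
    exact ⟨x, hx, rfl⟩
  rw [degreeIn, degree_eq_sum_sign (F := fun y => L (F (L.symm y))) (hK.image L.continuous)
    (L.continuous.comp (hF.comp L.symm.continuous)) (S.map L.toEquiv.toEmbedding) ?_ ?_ ?_
    (fun y => (L : E →L[ℝ] (ι → ℝ)).comp ((A (L.symm y)).comp (L.symm : (ι → ℝ) →L[ℝ] E)))
    ?_ ?_]
  · rw [Finset.sum_map]
    refine Finset.sum_congr rfl fun x _ => ?_
    rw [det_conj_coords]
    simp
  · rintro _ ⟨x, hx, rfl⟩ h0
    simp only [L.symm_apply_apply, L.map_eq_zero_iff] at h0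
    exact Finset.mem_map.2 ⟨x, hS x hx h0, rfl⟩
  · intro y hy
    obtain ⟨x, hx, rfl⟩ := hmap y hy
    simp [hS0 x hx]
  · intro y hy
    obtain ⟨x, hx, rfl⟩ := hmap y hy
    have := L.toHomeomorph.image_interior K
    rw [show (L '' K) = L.toHomeomorph '' K from rfl, ← this]
    exact ⟨x, hSK x hx, rfl⟩
  · intro y hy
    obtain ⟨x, hx, rfl⟩ := hmap y hy
    have hAx : HasFDerivAt F (A (L.symm (L x))) (L.symm (L x)) := by simpa using hA x hx
    exact (L : E →L[ℝ] (ι → ℝ)).hasFDerivAt.comp _ (hAx.comp _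
      (L.symm : (ι → ℝ) →L[ℝ] E).hasFDerivAt)
  · intro y hy
    obtain ⟨x, hx, rfl⟩ := hmap y hy
    rw [det_conj_coords, L.symm_apply_apply]
    exact hdet x hx

/-- Coordinates of a product. -/
noncomputable def prodCoords {α γ X Z : Type*} [NormedAddCommGroup X] [NormedSpace ℝ X]
    [NormedAddCommGroup Z] [NormedSpace ℝ Z] (L₁ : X ≃L[ℝ] (α → ℝ)) (L₂ : Z ≃L[ℝ] (γ → ℝ)) :
    (X × Z) ≃L[ℝ] (α ⊕ γ → ℝ) :=
  (L₁.prodCongr L₂).trans (sumCoords α γ).symm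

theorem degreeIn_prod {α γ X Z : Type*} [Fintype α] [Fintype γ]
    [NormedAddCommGroup X] [NormedSpace ℝ X]
    [NormedAddCommGroup Z] [NormedSpace ℝ Z] (L₁ : X ≃L[ℝ] (α → ℝ)) (L₂ : Z ≃L[ℝ] (γ → ℝ))
    {K₁ : Set X} {K₂ : Set Z} (hK₁ : IsCompact K₁)
    (hK₂ : IsCompact K₂) {U : Set Z} (hU0 : (0 : Z) ∈ U) (hUo : IsOpen U) (hUK : U ⊆ K₂)
    {G : X → X} (hG : ContDiff ℝ ∞ G) (hG0 : ∀ x ∈ frontier K₁, G x ≠ 0)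
    {h : X × Z → X × Z} (hh : ContDiff ℝ ∞ h)
    (hU1 : ∀ x, ∀ z ∈ U, h (x, z) = (G x, z))
    (hU2 : ∀ x ∈ K₁, ∀ z ∈ K₂, z ∉ U → h (x, z) ≠ 0) :
    degreeIn (prodCoords L₁ L₂) (K₁ ×ˢ K₂) h = degreeIn L₁ K₁ G := by
  have hsymm : ∀ x z, (prodCoords L₁ L₂).symm ((sumCoords α γ).symm (x, z)) =
      (L₁.symm x, L₂.symm z) := fun x z => by
    simp [prodCoords]
  have hval : ∀ p : X × Z, prodCoords L₁ L₂ p = (sumCoords α γ).symm (L₁ p.1, L₂ p.2) :=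
    fun p => rfl
  have himg : prodCoords L₁ L₂ '' (K₁ ×ˢ K₂) =
      (sumCoords α γ).symm '' ((L₁ '' K₁) ×ˢ (L₂ '' K₂)) := by
    rw [Set.prod_image_image_eq, Set.image_image]
    rfl
  rw [degreeIn, himg]
  have hUo' : IsOpen (L₂ '' U) := L₂.toHomeomorph.isOpenMap U hUo
  refine degree_prod (hK₁.image L₁.continuous) (hK₂.image L₂.continuous) (U := L₂ '' U)
    (hUo'.mem_nhds ⟨0, hU0, by simp⟩) hUo' (Set.image_mono hUK)
    (L₁.contDiff.comp (hG.comp L₁.symm.contDiff)) ?_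
    ((prodCoords L₁ L₂).contDiff.comp (hh.comp (prodCoords L₁ L₂).symm.contDiff)) ?_ ?_
  · intro y hy
    rw [Function.comp, Ne, L₁.map_eq_zero_iff]
    exact hG0 _ (mem_frontier_image L₁ hy)
  · rintro x _ ⟨z, hz, rfl⟩
    rw [hsymm, L₂.symm_apply_apply, hU1 _ z hz, hval]
    rfl
  · rintro _ ⟨x, hx, rfl⟩ _ ⟨z, hz, rfl⟩ hzU
    rw [hsymm, Ne, (prodCoords L₁ L₂).map_eq_zero_iff, L₂.symm_apply_apply, L₁.symm_apply_apply]
    exact hU2 x hx z hz fun h => hzU ⟨z, h, rfl⟩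

end Abstract

/-! ### Circle-equivariant maps. -/

/-- The complex vector space `ℂ^k`. -/
abbrev ComplexSpace (k : ℕ) : Type := EuclideanSpace ℂ (Fin k)

/-- Equivariance with respect to scalar multiplication by unit complex numbers in the second
summand. -/
def IsEquivariant {X Y : Type*} {k l : ℕ} (F : X × ComplexSpace k → Y × ComplexSpace l) : Prop :=
  ∀ (q : Circle) (x : X) (z : ComplexSpace k),
    F (x, (q : ℂ) • z) = ((F (x, z)).1, (q : ℂ) • (F (x, z)).2)

/-- Multiplication by a unit complex number, as an isometry. -/
noncomputable def circleIsometry (k : ℕ) (q : Circle) : ComplexSpace k ≃ₗᵢ[ℝ] ComplexSpace k where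
  toFun z := (q : ℂ) • z
  invFun z := ((q⁻¹ : Circle) : ℂ) • z
  map_add' z w := smul_add _ z w
  map_smul' r z := smul_comm _ r z
  left_inv z := by simp [smul_smul]
  right_inv z := by simp [smul_smul]
  norm_map' z := by
    change ‖(q : ℂ) • z‖ = ‖z‖
    rw [norm_smul, Circle.norm_coe, one_mul]

theorem IsEquivariant.snd_eq_zero {X Y : Type*} {k l : ℕ}
    {F : X × ComplexSpace k → Y × ComplexSpace l} (hF : IsEquivariant F) (x : X) :
    (F (x, 0)).2 = 0 := by
  have h := hF (-1) x 0
  rw [smul_zero] at h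
  have h2 := congrArg Prod.snd h
  have h3 : ((-1 : Circle) : ℂ) = -1 := rfl
  simp only [h3, neg_smul, one_smul] at h2
  have h4 : (2 : ℝ) • (F (x, 0)).2 = 0 := by
    rw [two_smul]
    exact eq_neg_iff_add_eq_zero.1 h2
  exact (smul_eq_zero.1 h4).resolve_left two_ne_zero

/-! ### Smoothing that preserves equivariance. -/

section Smoothing

variable {X : Type*} [NormedAddCommGroup X] [NormedSpace ℝ X] [FiniteDimensional ℝ X]

/-- An invariant mollifier: depending on `z` only through `‖z‖`, it makes convolution commute with
the circle action. -/
theorem exists_invariant_bump (X : Type*) [NormedAddCommGroup X] [NormedSpace ℝ X]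
    [FiniteDimensional ℝ X] (k : ℕ) {δ : ℝ} (hδ : 0 < δ) :
    ∃ g : X × ComplexSpace k → ℝ, ContDiff ℝ ∞ g ∧ HasCompactSupport g ∧ (∀ p, 0 ≤ g p) ∧
      g 0 ≠ 0 ∧ Function.support g ⊆ Metric.ball 0 δ ∧
      ∀ (q : Circle) x z, g (x, (q : ℂ) • z) = g (x, z) := by
  set b : ContDiffBump (0 : X) := ⟨δ / 2, δ, by positivity, by linarith⟩ with hb
  set g : X × ComplexSpace k → ℝ := fun p => b p.1 * Real.smoothTransition (δ ^ 2 - ‖p.2‖ ^ 2)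
    with hg
  have hsupp : Function.support g ⊆ Metric.ball 0 δ := by
    intro p hp
    have h1 : b p.1 ≠ 0 := left_ne_zero_of_mul hp
    have h2 : Real.smoothTransition (δ ^ 2 - ‖p.2‖ ^ 2) ≠ 0 := right_ne_zero_of_mul hp
    rw [mem_ball_zero_iff, Prod.norm_def, max_lt_iff]
    constructor
    · by_contra h
      exact h1 (b.zero_of_le_dist (by simpa [hb] using h))
    · by_contra h
      rw [not_lt] at h
      exact h2 (Real.smoothTransition.zero_of_nonpos
        (by nlinarith [norm_nonneg p.2]))
  refine ⟨g, ?_, ?_, ?_, ?_, hsupp, ?_⟩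
  · have h1 : ContDiff ℝ ∞ fun p : X × ComplexSpace k => b p.1 := b.contDiff.comp contDiff_fst
    have h2 : ContDiff ℝ ∞ fun p : X × ComplexSpace k =>
        Real.smoothTransition (δ ^ 2 - ‖p.2‖ ^ 2) :=
      Real.smoothTransition.contDiff.comp
        (contDiff_const.sub ((contDiff_norm_sq ℝ).comp contDiff_snd))
    exact h1.mul h2
  · exact HasCompactSupport.of_support_subset_isCompact (isCompact_closedBall 0 δ)
      (hsupp.trans Metric.ball_subset_closedBall)
  · exact fun p => mul_nonneg b.nonneg (Real.smoothTransition.nonneg _)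
  · refine mul_ne_zero ?_ ?_
    · rw [Prod.fst_zero, b.one_of_mem_closedBall (Metric.mem_closedBall_self (by positivity))]
      exact one_ne_zero
    · refine (Real.smoothTransition.pos_of_pos ?_).ne'
      simpa using pow_pos hδ 2
  · intro q x z
    simp only [hg, norm_smul, Circle.norm_coe, one_mul]

/-- Equivariant smooth approximation. -/
theorem exists_equivariant_approx {k l : ℕ} {F : X × ComplexSpace k → X × ComplexSpace l}
    (hF : Continuous F) (hFe : IsEquivariant F) {K : Set (X × ComplexSpace k)} (hK : IsCompact K)
    {ε : ℝ} (hε : 0 < ε) :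
    ∃ G : X × ComplexSpace k → X × ComplexSpace l, ContDiff ℝ ∞ G ∧ IsEquivariant G ∧
      ∀ p ∈ K, ‖G p - F p‖ ≤ ε := by
  let : MeasurableSpace X := borel X
  have : BorelSpace X := ⟨rfl⟩
  set μ : Measure (X × ComplexSpace k) := (Measure.addHaar : Measure X).prod volume with hμ
  have hμH : μ.IsAddHaarMeasure := by rw [hμ]; infer_instance
  have : BorelSpace (X × ComplexSpace k) := inferInstance
  have : μ.IsNegInvariant := inferInstance
  have hunif := hK.uniformContinuousAt_of_continuousAt F (fun p _ => hF.continuousAt)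
    (Metric.dist_mem_uniformity hε)
  obtain ⟨δ, hδ, hδF⟩ := Metric.mem_uniformity_dist.1 hunif
  obtain ⟨g, hg, hgc, hg0, hgne, hgs, hginv⟩ := exists_invariant_bump X k hδ
  have hI : 0 < ∫ p, g p ∂μ :=
    hg.continuous.integral_pos_of_hasCompactSupport_nonneg_nonzero hgc hg0 hgne
  set ρ : X × ComplexSpace k → ℝ := fun p => (∫ p, g p ∂μ)⁻¹ * g p with hρ
  have hρs : ContDiff ℝ ∞ ρ := contDiff_const.mul hg
  have hρc : HasCompactSupport ρ := hgc.mul_left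
  have hρI : ∫ p, ρ p ∂μ = 1 := by
    simp only [hρ]
    rw [integral_const_mul, inv_mul_cancel₀ hI.ne']
  refine ⟨convolution ρ F (ContinuousLinearMap.lsmul ℝ ℝ) μ,
    hρc.contDiff_convolution_left _ hρs hF.locallyIntegrable, ?_, ?_⟩
  · intro q x z
    set R : X × ComplexSpace k → X × ComplexSpace k := Prod.map id (circleIsometry k q) with hR
    have hRm : MeasurePreserving R μ μ :=
      (MeasurePreserving.id _).prod (circleIsometry k q).measurePreserving
    have hRe : MeasurableEmbedding R :=
      ((MeasurableEquiv.refl X).prodCongr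
        (circleIsometry k q).toHomeomorph.toMeasurableEquiv).measurableEmbedding
    have hRsub : ∀ p p', R p - R p' = R (p - p') := fun p p' => by
      simp [hR, Prod.ext_iff]
    set R' : (X × ComplexSpace l) ≃L[ℝ] (X × ComplexSpace l) :=
      (ContinuousLinearEquiv.refl ℝ X).prodCongr (circleIsometry l q).toContinuousLinearEquiv
      with hR'
    have hFR : ∀ p, F (R p) = R' (F p) := fun p => hFe q p.1 p.2
    have hρR : ∀ p, ρ (R p) = ρ p := fun p => by
      simp only [hρ]
      congr 1
      exact hginv q p.1 p.2
    change convolution ρ F (ContinuousLinearMap.lsmul ℝ ℝ) μ (R (x, z)) =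
      R' (convolution ρ F (ContinuousLinearMap.lsmul ℝ ℝ) μ (x, z))
    simp only [convolution, ContinuousLinearMap.lsmul_apply]
    -- Rotate the integration variable, which preserves the measure and the kernel, and pull the
    -- linear rotation of the target out of the integral.
    rw [← hRm.integral_comp hRe, ← R'.integral_comp_comm]
    refine integral_congr_ae (Filter.Eventually.of_forall fun p => ?_)
    simp only [hρR, hRsub, hFR, map_smul]
  · intro p hp
    rw [← dist_eq_norm]
    refine dist_convolution_le (R := δ) hε.le ?_ ?_ hρI hF.aestronglyMeasurable fun y hy => ?_
    · intro y hy
      exact hgs (right_ne_zero_of_mul hy)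
    · exact fun y => mul_nonneg (inv_nonneg.2 hI.le) (hg0 y)
    · rw [dist_comm]
      exact (hδF (by rwa [dist_comm]) hp : dist (F p) (F y) < ε).le

end Smoothing

/-! ### Transversality off the fixed point set, by a Hausdorff dimension count. -/

section Generic

variable {X : Type*} [NormedAddCommGroup X] [NormedSpace ℝ X] [FiniteDimensional ℝ X]

/-- The solution of the equation `F (x, z) + (c, ∑ z_i b_i) = 0` in `c` and `b_j`, where `z` has
`j`-th coordinate `t` and other coordinates `w`, and `b'` are the other `b_i`. -/
noncomputable def solveColumn {k : ℕ}
    (F : X × ComplexSpace (k + 1) → X × ComplexSpace (k + 1)) (j : Fin (k + 1))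
    (p : X × ℝ × (Fin k → ℂ) × (Fin k → ComplexSpace (k + 1))) :
    X × (Fin (k + 1) → ComplexSpace (k + 1)) :=
  (-(F (p.1, WithLp.toLp 2 (Fin.insertNth (α := fun _ => ℂ) j (p.2.1 : ℂ) p.2.2.1))).1,
    Fin.insertNth (α := fun _ => ComplexSpace (k + 1)) j (-(p.2.1⁻¹ •
      ((F (p.1, WithLp.toLp 2 (Fin.insertNth (α := fun _ => ℂ) j (p.2.1 : ℂ) p.2.2.1))).2 +
        ∑ i, p.2.2.1 i • p.2.2.2 i))) p.2.2.2)

omit [FiniteDimensional ℝ X] in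
theorem contDiffOn_solveColumn {k : ℕ}
    {F : X × ComplexSpace (k + 1) → X × ComplexSpace (k + 1)} (hF : ContDiff ℝ ∞ F)
    (j : Fin (k + 1)) : ContDiffOn ℝ 1 (solveColumn F j) {p | 0 < p.2.1} := by
  have hF1 : ContDiff ℝ 1 F := hF.of_le (by simp)
  have hz : ContDiff ℝ 1 fun p : X × ℝ × (Fin k → ℂ) × (Fin k → ComplexSpace (k + 1)) =>
      (WithLp.toLp 2 (Fin.insertNth (α := fun _ => ℂ) j (p.2.1 : ℂ) p.2.2.1) :
        ComplexSpace (k + 1)) := by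
    refine PiLp.contDiff_toLp.comp (contDiff_pi.2 fun i => ?_)
    rcases Fin.eq_self_or_eq_succAbove j i with rfl | ⟨l, rfl⟩
    · simp only [Fin.insertNth_apply_same]
      exact Complex.ofRealCLM.contDiff.comp (contDiff_fst.comp contDiff_snd)
    · simp only [Fin.insertNth_apply_succAbove]
      fun_prop
  have hFz : ContDiff ℝ 1 fun p : X × ℝ × (Fin k → ℂ) × (Fin k → ComplexSpace (k + 1)) =>
      F (p.1, WithLp.toLp 2 (Fin.insertNth (α := fun _ => ℂ) j (p.2.1 : ℂ) p.2.2.1)) :=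
    hF1.comp (contDiff_fst.prodMk hz)
  have hsum : ContDiff ℝ 1 fun p : X × ℝ × (Fin k → ℂ) × (Fin k → ComplexSpace (k + 1)) =>
      ∑ i, p.2.2.1 i • p.2.2.2 i :=
    ContDiff.sum fun i _ => by fun_prop
  refine ContDiffOn.prodMk (contDiff_fst.comp hFz).neg.contDiffOn (contDiffOn_pi.2 fun i => ?_)
  rcases Fin.eq_self_or_eq_succAbove j i with rfl | ⟨l, rfl⟩
  · simp only [Fin.insertNth_apply_same]
    refine ((ContDiffOn.inv (contDiff_fst.comp contDiff_snd).contDiffOn fun p hp => ne_of_gt hp).smul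
      ((contDiff_snd.comp hFz).add hsum).contDiffOn).neg
  · simp only [Fin.insertNth_apply_succAbove]
    fun_prop

theorem exists_circle_mul_eq (w : ℂ) : ∃ q : Circle, (q : ℂ) * w = (‖w‖ : ℂ) := by
  refine ⟨Circle.exp (-w.arg), ?_⟩
  conv_lhs => rw [← Complex.norm_mul_exp_arg_mul_I w]
  rw [Circle.coe_exp, mul_left_comm, ← Complex.exp_add]
  simp

/-- A generic perturbation by `(x, z) ↦ (c, B z)` has no zeros off the fixed point set. -/
theorem exists_generic_perturbation {k : ℕ}
    {F : X × ComplexSpace (k + 1) → X × ComplexSpace (k + 1)} (hF : ContDiff ℝ ∞ F)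
    (hFe : IsEquivariant F) {η : ℝ} (hη : 0 < η) :
    ∃ (c : X) (b : Fin (k + 1) → ComplexSpace (k + 1)), ‖c‖ < η ∧ (∀ i, ‖b i‖ < η) ∧
      ∀ x z, z ≠ 0 → F (x, z) + (c, ∑ i, z i • b i) ≠ 0 := by
  set D := X × ℝ × (Fin k → ℂ) × (Fin k → ComplexSpace (k + 1)) with hD
  set P := X × (Fin (k + 1) → ComplexSpace (k + 1)) with hP
  set bad : Set P := ⋃ j, solveColumn F j '' {p | 0 < p.2.1} with hbad
  -- The domain of `solveColumn` is one real dimension short: the complex column `b_j` is traded for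
  -- `k` complex coordinates and one positive real one. The missing dimension is the phase of `z_j`,
  -- normalized away by the circle action.
  have hfr : Module.finrank ℝ D < Module.finrank ℝ P := by
    have hC : ∀ l : ℕ, Module.finrank ℝ (ComplexSpace l) = 2 * l := fun l => by
      rw [← Module.finrank_mul_finrank ℝ ℂ (ComplexSpace l), Complex.finrank_real_complex,
        finrank_euclideanSpace_fin]
    have hsq : (k + 1) * (2 * (k + 1)) = k * (2 * (k + 1)) + 2 * k + 2 := by ring
    change Module.finrank ℝ (X × ℝ × (Fin k → ℂ) × (Fin k → ComplexSpace (k + 1))) <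
      Module.finrank ℝ (X × (Fin (k + 1) → ComplexSpace (k + 1)))
    simp only [Module.finrank_prod, Module.finrank_self, Module.finrank_pi_fintype,
      Complex.finrank_real_complex, hC, Finset.sum_const, Finset.card_univ, Fintype.card_fin,
      smul_eq_mul]
    omega
  have hdim : dimH bad < Module.finrank ℝ P := by
    refine lt_of_le_of_lt ?_ (Nat.cast_lt.2 hfr)
    rw [hbad, dimH_iUnion]
    refine iSup_le fun j => ?_
    have hconv : Convex ℝ {p : D | 0 < p.2.1} :=
      (convex_Ioi (0 : ℝ)).is_linear_preimage
        ((LinearMap.fst ℝ ℝ _).comp (LinearMap.snd ℝ X _)).isLinear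
    refine ((contDiffOn_solveColumn hF j).dimH_image_le hconv subset_rfl).trans ?_
    rw [← Real.dimH_univ_eq_finrank]
    exact dimH_mono (Set.subset_univ _)
  obtain ⟨p, hp, hpη⟩ := (dense_compl_of_dimH_lt_finrank hdim).exists_dist_lt (0 : P) hη
  rw [dist_zero_left] at hpη
  have hp2 : ‖p.2‖ < η := (norm_snd_le p).trans_lt hpη
  refine ⟨p.1, p.2, (norm_fst_le p).trans_lt hpη, fun i => (norm_le_pi_norm p.2 i).trans_lt hp2,
    fun x z hz h0 => hp ?_⟩
  obtain ⟨j, hj⟩ : ∃ j, z j ≠ 0 := by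
    by_contra! hcon
    exact hz (by ext j; simpa using hcon j)
  -- Equivariance enters here. The perturbation is complex linear in `z` and fixes the phase of `c`,
  -- so a zero can be rotated until `z_j` is positive; then `c` and `b_j` are determined by the
  -- other data and the parameter is bad.
  obtain ⟨q, hq⟩ := exists_circle_mul_eq (z j)
  have hpos : 0 < ‖z j‖ := norm_pos_iff.2 hj
  refine Set.mem_iUnion.2 ⟨j, (x, ‖z j‖, fun l => (q : ℂ) * z (j.succAbove l),
    fun l => p.2 (j.succAbove l)), hpos, ?_⟩
  have hzq : (WithLp.toLp 2 (Fin.insertNth (α := fun _ => ℂ) j ((‖z j‖ : ℝ) : ℂ)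
      fun l => (q : ℂ) * z (j.succAbove l)) : ComplexSpace (k + 1)) = (q : ℂ) • z := by
    ext i
    rcases Fin.eq_self_or_eq_succAbove j i with rfl | ⟨l, rfl⟩
    · simp [hq]
    · simp
  have h1 : (F (x, z)).1 = -p.1 := eq_neg_of_add_eq_zero_left (congrArg Prod.fst h0)
  have h2 : (F (x, z)).2 = -∑ i, z i • p.2 i :=
    eq_neg_of_add_eq_zero_left (congrArg Prod.snd h0)
  simp only [solveColumn, hzq]
  rw [hFe q x z]
  refine Prod.ext ?_ (funext fun i => ?_)
  · simp [h1]
  · rcases Fin.eq_self_or_eq_succAbove j i with rfl | ⟨l, rfl⟩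
    · simp only [Fin.insertNth_apply_same]
      have hB : (q : ℂ) • (F (x, z)).2 + ∑ l, ((q : ℂ) * z (i.succAbove l)) • p.2 (i.succAbove l) =
          -((‖z i‖ : ℂ) • p.2 i) := by
        rw [h2, Fin.sum_univ_succAbove _ i, smul_neg, smul_add, smul_smul, hq, Finset.smul_sum,
          Finset.sum_congr rfl fun l _ => smul_smul (q : ℂ) _ _, neg_add, neg_add_cancel_right]
      rw [hB, smul_neg, neg_neg, Complex.coe_smul, smul_smul, inv_mul_cancel₀ hpos.ne', one_smul]
    · simp only [Fin.insertNth_apply_succAbove]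

end Generic

/-! ### Comparing the degree of an equivariant map with that of its fixed part. -/

section FixedDegree

/-- A smooth rotation invariant cutoff function: `0` on the ball of radius `δ`, `1` off the ball of
radius `2 δ`. -/
noncomputable def radialCutoff {k : ℕ} (δ : ℝ) (z : ComplexSpace k) : ℝ :=
  Real.smoothTransition ((‖z‖ ^ 2 - δ ^ 2) / (3 * δ ^ 2))

section
variable {k : ℕ} {δ : ℝ} {z : ComplexSpace k}

theorem contDiff_radialCutoff : ContDiff ℝ ∞ (radialCutoff (k := k) δ) :=
  Real.smoothTransition.contDiff.comp
    (((contDiff_norm_sq ℝ).sub contDiff_const).div_const _)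

theorem radialCutoff_of_le (h : ‖z‖ ≤ δ) : radialCutoff δ z = 0 := by
  apply Real.smoothTransition.zero_of_nonpos
  apply div_nonpos_of_nonpos_of_nonneg
  · nlinarith [norm_nonneg z]
  · positivity

theorem radialCutoff_of_ge (hδ : 0 < δ) (h : 2 * δ ≤ ‖z‖) : radialCutoff δ z = 1 := by
  apply Real.smoothTransition.one_of_one_le
  rw [one_le_div (by positivity)]
  nlinarith [norm_nonneg z]

theorem radialCutoff_nonneg : 0 ≤ radialCutoff δ z := Real.smoothTransition.nonneg _

theorem radialCutoff_le_one : radialCutoff δ z ≤ 1 := Real.smoothTransition.le_one _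

theorem radialCutoff_smul (q : Circle) : radialCutoff δ ((q : ℂ) • z) = radialCutoff δ z := by
  simp only [radialCutoff, norm_smul, Circle.norm_coe, one_mul]

end

variable {X : Type*} [NormedAddCommGroup X] [NormedSpace ℝ X]

omit [NormedSpace ℝ X] in
theorem mem_frontier_prod_zero {k : ℕ} {K : Set X} {x : X}
    (hx : x ∈ frontier K) :
    ((x, 0) : X × ComplexSpace k) ∈ frontier (K ×ˢ Metric.closedBall (0 : ComplexSpace k) 1) := by
  rw [frontier_prod_eq]
  exact Or.inr ⟨hx, subset_closure (Metric.mem_closedBall_self zero_le_one)⟩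

variable [FiniteDimensional ℝ X] {α γ : Type*} [Fintype α] [Fintype γ]

/-- An equivariant map and its restriction to the fixed point set have the same degree, if it is
the identity in the normal directions near the fixed point set. -/
theorem degreeIn_eq_of_normal_form {k : ℕ} (L₁ : X ≃L[ℝ] (α → ℝ))
    (L₂ : ComplexSpace (k + 1) ≃L[ℝ] (γ → ℝ)) {K : Set X} (hK : IsCompact K)
    {F : X × ComplexSpace (k + 1) → X × ComplexSpace (k + 1)} (hF : ContDiff ℝ ∞ F)
    (hFe : IsEquivariant F)
    (h0 : ∀ p ∈ frontier (K ×ˢ Metric.closedBall (0 : ComplexSpace (k + 1)) 1), F p ≠ 0)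
    {G : X → X} (hG : ContDiff ℝ ∞ G) {δ : ℝ} (hδ : 0 < δ) (hδ1 : δ ≤ 1)
    (hnf : ∀ x z, ‖z‖ ≤ δ → F (x, z) = (G x, z)) :
    degreeIn (prodCoords L₁ L₂) (K ×ˢ Metric.closedBall 0 1) F = degreeIn L₁ K G := by
  have hKK := hK.prod (isCompact_closedBall (0 : ComplexSpace (k + 1)) 1)
  obtain ⟨m, hm, hmF⟩ := (isCompact_frontier hKK).exists_forall_le' hF.continuous.norm.continuousOn
    (a := 0) (fun x hx => norm_pos_iff.2 (h0 x hx))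
  -- The bound `(k + 1) * η < m` keeps the frontier free of zeros during the perturbation; `(k + 1)
  -- * η < 1` makes `‖B z‖ < ‖z‖` for `z ≠ 0`.
  set η : ℝ := min (m / 2) 1 / (k + 2) with hη
  have hη0 : 0 < η := by positivity
  have hηm : η * (k + 2) = min (m / 2) 1 := div_mul_cancel₀ _ (by positivity)
  have hη1 : (k + 1) * η < 1 := by nlinarith [min_le_right (m / 2) 1]
  have hη2 : (k + 1) * η < m := by nlinarith [min_le_left (m / 2) 1]
  have hη3 : η < m := by nlinarith [min_le_left (m / 2) 1]
  obtain ⟨c, b, hc, hb, hgen⟩ := exists_generic_perturbation hF hFe hη0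
  set B : ComplexSpace (k + 1) → ComplexSpace (k + 1) := fun z => ∑ i, z i • b i with hB
  have hBn : ∀ z, ‖B z‖ ≤ (k + 1) * η * ‖z‖ := fun z => by
    refine (norm_sum_le _ _).trans ?_
    have : ∀ i ∈ Finset.univ, ‖z i • b i‖ ≤ η * ‖z‖ := fun i _ => by
      rw [norm_smul, mul_comm]
      exact mul_le_mul (hb i).le (PiLp.norm_apply_le z i) (norm_nonneg _) hη0.le
    refine (Finset.sum_le_card_nsmul _ _ _ this).trans (le_of_eq ?_)
    simp
    ring
  have hBs : ContDiff ℝ ∞ B := ContDiff.sum fun i _ => by fun_prop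
  -- The perturbation is off for `‖z‖ ≤ δ / 2`, so the product form survives there, and fully on for
  -- `‖z‖ ≥ δ`, where genericity excludes zeros.
  set h : X × ComplexSpace (k + 1) → X × ComplexSpace (k + 1) := fun p =>
    F p + radialCutoff (δ / 2) p.2 • (c, B p.2) with hh
  have hhs : ContDiff ℝ ∞ h :=
    hF.add ((contDiff_radialCutoff.comp contDiff_snd).smul
      (contDiff_const.prodMk (hBs.comp contDiff_snd)))
  have hstep : degreeIn (prodCoords L₁ L₂) (K ×ˢ Metric.closedBall 0 1) F =
      degreeIn (prodCoords L₁ L₂) (K ×ˢ Metric.closedBall 0 1) h := by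
    refine degreeIn_eq_of_norm_sub_lt _ hKK hF.continuous hhs.continuous fun p hp => ?_
    refine lt_of_lt_of_le ?_ (hmF p hp)
    have hp2 : ‖p.2‖ ≤ 1 := mem_closedBall_zero_iff.1 (hKK.isClosed.frontier_subset hp).2
    have h1 : h p - F p = radialCutoff (δ / 2) p.2 • (c, B p.2) := add_sub_cancel_left _ _
    rw [h1, norm_smul, Real.norm_of_nonneg radialCutoff_nonneg]
    refine (mul_le_of_le_one_left (norm_nonneg _) radialCutoff_le_one).trans_lt ?_
    rw [Prod.norm_def, max_lt_iff]
    refine ⟨hc.trans hη3, (hBn _).trans_lt ?_⟩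
    exact (mul_le_of_le_one_right (by positivity) hp2).trans_lt hη2
  rw [hstep]
  refine degreeIn_prod L₁ L₂ hK (isCompact_closedBall _ _) (U := Metric.ball 0 (δ / 2))
    (Metric.mem_ball_self (by positivity)) Metric.isOpen_ball
    ((Metric.ball_subset_ball (by linarith)).trans Metric.ball_subset_closedBall) hG ?_ hhs ?_ ?_
  · intro x hx hGx
    refine h0 _ (mem_frontier_prod_zero hx) ?_
    rw [hnf x 0 (by simpa using hδ.le), hGx]
    rfl
  · intro x z hz
    rw [mem_ball_zero_iff] at hz
    simp only [hh]
    rw [radialCutoff_of_le hz.le, zero_smul, add_zero, hnf x z (by linarith)]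
  · intro x _ z _ hzU
    rw [mem_ball_zero_iff, not_lt] at hzU
    have hz0 : z ≠ 0 := fun h => by
      rw [h, norm_zero] at hzU
      linarith
    rcases le_total ‖z‖ δ with hzδ | hzδ
    · intro hzero
      have h2 := congrArg Prod.snd hzero
      simp only [hh, hnf x z hzδ, Prod.snd_add, Prod.smul_snd, Prod.snd_zero] at h2
      have h3 : ‖z‖ = ‖radialCutoff (δ / 2) z • B z‖ := by
        rw [eq_neg_of_add_eq_zero_left h2, norm_neg, ← eq_neg_of_add_eq_zero_left h2]
      rw [norm_smul, Real.norm_of_nonneg radialCutoff_nonneg] at h3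
      have h4 := mul_le_of_le_one_left (norm_nonneg (B z))
        (radialCutoff_le_one (δ := δ / 2) (z := z))
      have h5 := hBn z
      have h6 : 0 < ‖z‖ := norm_pos_iff.2 hz0
      nlinarith
    · simp only [hh]
      rw [radialCutoff_of_ge (by positivity) (by linarith), one_smul]
      exact hgen x z hz0

/-- An equivariant map and its restriction to the fixed point set have the same degree. -/
theorem degreeIn_eq_degreeIn_fixed {k : ℕ} (L₁ : X ≃L[ℝ] (α → ℝ))
    (L₂ : ComplexSpace (k + 1) ≃L[ℝ] (γ → ℝ)) {K : Set X} (hK : IsCompact K)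
    {F : X × ComplexSpace (k + 1) → X × ComplexSpace (k + 1)} (hF : ContDiff ℝ ∞ F)
    (hFe : IsEquivariant F)
    (h0 : ∀ p ∈ frontier (K ×ˢ Metric.closedBall (0 : ComplexSpace (k + 1)) 1), F p ≠ 0) :
    degreeIn (prodCoords L₁ L₂) (K ×ˢ Metric.closedBall 0 1) F =
      degreeIn L₁ K (fun x => (F (x, 0)).1) := by
  have hKK := hK.prod (isCompact_closedBall (0 : ComplexSpace (k + 1)) 1)
  set G : X → X := fun x => (F (x, 0)).1 with hGdef
  have hG : ContDiff ℝ ∞ G := contDiff_fst.comp (hF.comp (contDiff_id.prodMk contDiff_const))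
  have hFG : ∀ x, F (x, 0) = (G x, 0) := fun x => Prod.ext rfl (hFe.snd_eq_zero x)
  -- The frontier points at which the first component could be deformed through zero. This compact
  -- set misses `z = 0`, where that component equals `G x ≠ 0`, so it keeps a positive distance `r`
  -- from the fixed set.
  set C : Set (X × ComplexSpace (k + 1)) :=
    frontier (K ×ˢ Metric.closedBall (0 : ComplexSpace (k + 1)) 1) ∩
      {p | ‖G p.1‖ ≤ ‖(F p).1 - G p.1‖} with hC
  have hCc : IsCompact C := by
    refine (isCompact_frontier hKK).inter_right ?_
    have h1 := hF.continuous
    have h2 := hG.continuous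
    exact isClosed_le (by fun_prop) (by fun_prop)
  obtain ⟨r, hr, hrC⟩ := hCc.exists_forall_le' (f := fun p => ‖p.2‖) (by fun_prop) (a := 0) (by
    rintro ⟨x, z⟩ ⟨hp1, hp2⟩
    refine norm_pos_iff.2 fun hz => ?_
    change z = 0 at hz
    subst hz
    simp only [Set.mem_ofPred_eq, hFG, sub_self, norm_zero] at hp2
    refine h0 _ hp1 ?_
    rw [hFG, norm_le_zero_iff.1 hp2]
    rfl)
  set δ : ℝ := min (r / 3) 1 with hδ
  have hδ0 : 0 < δ := by positivity
  have hδr : 2 * δ < r := by linarith [min_le_left (r / 3) 1]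
  have hnear : ∀ x z, (x, z) ∈ frontier (K ×ˢ Metric.closedBall (0 : ComplexSpace (k + 1)) 1) →
      ‖z‖ ≤ 2 * δ → ‖(F (x, z)).1 - G x‖ < ‖G x‖ := fun x z hp hz => by
    by_contra hcon
    have := hrC (x, z) ⟨hp, not_lt.1 hcon⟩
    simp only at this
    linarith
  -- The model `(G x, z)` near the fixed set, interpolated to `F`. Along the segment from `F` only
  -- the first component is controlled, and it suffices for `‖z‖ ≤ 2 * δ`; beyond that nothing
  -- changes.
  set F' : X × ComplexSpace (k + 1) → X × ComplexSpace (k + 1) := fun p =>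
    (G p.1, p.2) + radialCutoff δ p.2 • (F p - (G p.1, p.2)) with hF'
  have hF's : ContDiff ℝ ∞ F' := by
    have hP : ContDiff ℝ ∞ fun p : X × ComplexSpace (k + 1) => (G p.1, p.2) :=
      (hG.comp contDiff_fst).prodMk contDiff_snd
    exact hP.add ((contDiff_radialCutoff.comp contDiff_snd).smul (hF.sub hP))
  have hF'e : IsEquivariant F' := fun q x z => by
    simp only [hF', hFe q x z, radialCutoff_smul]
    refine Prod.ext ?_ ?_
    · simp
    · simp only [Prod.snd_add, Prod.smul_snd, Prod.snd_sub, smul_add, smul_sub]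
      rw [smul_comm (q : ℂ) (radialCutoff δ z), smul_comm (q : ℂ) (radialCutoff δ z)]
  have hseg : ∀ p ∈ frontier (K ×ˢ Metric.closedBall (0 : ComplexSpace (k + 1)) 1),
      ∀ t ∈ Set.Icc (0 : ℝ) 1, (1 - t) • F p + t • F' p ≠ 0 := by
    rintro ⟨x, z⟩ hp t ht hzero
    rcases le_total ‖z‖ (2 * δ) with hz | hz
    · set a := 1 - t * (1 - radialCutoff δ z) with ha
      have ha1 : a ≤ 1 := by
        have := mul_nonneg ht.1 (sub_nonneg.2 (radialCutoff_le_one (δ := δ) (z := z)))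
        linarith
      have ha0 : 0 ≤ a := by
        have := mul_le_one₀ ht.2 (sub_nonneg.2 (radialCutoff_le_one (δ := δ) (z := z)))
          (by linarith [radialCutoff_nonneg (δ := δ) (z := z)])
        linarith
      have h1 := congrArg Prod.fst hzero
      simp only [hF', Prod.fst_add, Prod.smul_fst, Prod.fst_sub, Prod.fst_zero] at h1
      have h2 : G x = -(a • ((F (x, z)).1 - G x)) := by
        rw [eq_neg_iff_add_eq_zero, ← h1, ha]
        module
      have h3 : ‖G x‖ = a * ‖(F (x, z)).1 - G x‖ := by
        conv_lhs => rw [h2]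
        rw [norm_neg, norm_smul, Real.norm_of_nonneg ha0]
      have h4 := hnear x z hp hz
      nlinarith [norm_nonneg ((F (x, z)).1 - G x)]
    · refine h0 _ hp ?_
      rw [← hzero]
      simp only [hF', radialCutoff_of_ge hδ0 hz]
      module
  rw [degreeIn_eq_of_segment _ hKK hF.continuous hF's.continuous hseg]
  refine degreeIn_eq_of_normal_form L₁ L₂ hK hF's hF'e ?_ hG hδ0 (min_le_right _ _) ?_
  · intro p hp hzero
    exact hseg p hp 1 ⟨zero_le_one, le_rfl⟩ (by simp [hzero])
  · intro x z hz
    simp only [hF', radialCutoff_of_le hz, zero_smul, add_zero]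

/-- Padding a vector with zeros. -/
noncomputable def padding (n k : ℕ) : ComplexSpace n →ₗ[ℂ] ComplexSpace k where
  toFun z := WithLp.toLp 2 fun i => if h : (i : ℕ) < n then z ⟨i, h⟩ else 0
  map_add' z w := by
    ext i
    by_cases h : (i : ℕ) < n <;> simp [h]
  map_smul' c z := by
    ext i
    by_cases h : (i : ℕ) < n <;> simp [h]

theorem padding_injective {n k : ℕ} (h : n ≤ k) : Function.Injective (padding n k) := by
  intro z w hzw
  ext i
  have := congrArg (fun v : ComplexSpace k => v ⟨i, i.2.trans_le h⟩) hzw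
  simpa [padding] using this

theorem not_surjective_padding {n k : ℕ} (h : n < k) : ¬ Function.Surjective (padding n k) := by
  intro hs
  have := LinearMap.finrank_le_finrank_of_surjective hs
  simp at this
  omega

/-- The restriction to the fixed point sets of an equivariant map `X ⊕ ℂ^(k+1) → X ⊕ ℂ^n`
without zeros on the boundary has degree zero if `n ≤ k`. -/
theorem degreeIn_fixed_eq_zero {n k : ℕ} (hnk : n ≤ k) (L₁ : X ≃L[ℝ] (α → ℝ))
    {K : Set X} (hK : IsCompact K)
    {F : X × ComplexSpace (k + 1) → X × ComplexSpace n} (hF : Continuous F)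
    (hFe : IsEquivariant F)
    (h0 : ∀ p ∈ frontier (K ×ˢ Metric.closedBall (0 : ComplexSpace (k + 1)) 1), F p ≠ 0) :
    degreeIn L₁ K (fun x => (F (x, 0)).1) = 0 := by
  have hKK := hK.prod (isCompact_closedBall (0 : ComplexSpace (k + 1)) 1)
  obtain ⟨m, hm, hmF⟩ := (isCompact_frontier hKK).exists_forall_le' hF.norm.continuousOn
    (a := 0) (fun x hx => norm_pos_iff.2 (h0 x hx))
  obtain ⟨G, hG, hGe, hGF⟩ := exists_equivariant_approx hF hFe hKK (half_pos hm)
  have hGF' : ∀ p ∈ frontier (K ×ˢ Metric.closedBall (0 : ComplexSpace (k + 1)) 1),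
      ‖G p - F p‖ < ‖F p‖ := fun p hp => by
    linarith [hmF p hp, hGF p (hKK.isClosed.frontier_subset hp)]
  have hG0 : ∀ p ∈ frontier (K ×ˢ Metric.closedBall (0 : ComplexSpace (k + 1)) 1),
      G p ≠ 0 := fun p hp hGp => by
    have := hGF' p hp
    rw [hGp, zero_sub, norm_neg] at this
    exact lt_irrefl _ this
  set J : ComplexSpace n →L[ℝ] ComplexSpace (k + 1) :=
    ((padding n (k + 1)).restrictScalars ℝ).toContinuousLinearMap with hJ
  have hJa : ∀ z, J z = padding n (k + 1) z := fun z => rfl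
  set P : X × ComplexSpace n →L[ℝ] X × ComplexSpace (k + 1) :=
    (ContinuousLinearMap.id ℝ X).prodMap J with hP
  have hPG : ContDiff ℝ ∞ (fun p => P (G p)) := P.contDiff.comp hG
  have hPe : IsEquivariant (fun p => P (G p)) := fun q x z => by
    change P (G (x, (q : ℂ) • z)) = _
    rw [hGe q x z]
    refine Prod.ext rfl ?_
    change padding n (k + 1) ((q : ℂ) • (G (x, z)).2) = (q : ℂ) • padding n (k + 1) (G (x, z)).2
    exact map_smul _ _ _
  have hP0 : ∀ p ∈ frontier (K ×ˢ Metric.closedBall (0 : ComplexSpace (k + 1)) 1),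
      P (G p) ≠ 0 := fun p hp hPp => by
    have hPp1 : (P (G p)).1 = 0 := by rw [hPp]; rfl
    have hPp2 : (P (G p)).2 = 0 := by rw [hPp]; rfl
    refine hG0 p hp (Prod.ext hPp1 ?_)
    apply padding_injective (hnk.trans (Nat.le_succ k))
    rw [Prod.snd_zero, map_zero]
    exact hPp2
  have hdet : ∀ p, (fderiv ℝ (fun p => P (G p)) p).det = 0 := fun p => by
    have hd : HasFDerivAt (fun p => P (G p)) (P.comp (fderiv ℝ G p)) p :=
      P.hasFDerivAt.comp p ((hG.differentiable (by simp)).differentiableAt).hasFDerivAt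
    rw [hd.fderiv]
    by_contra hne
    -- An invertible differential would make its second component surjective, but that factors
    -- through `padding`.
    refine not_surjective_padding (Nat.lt_succ_of_le hnk) fun w => ?_
    obtain ⟨v, hv⟩ := ((P.comp (fderiv ℝ G p)).toContinuousLinearEquivOfDetNeZero hne).surjective
      (0, w)
    exact ⟨(fderiv ℝ G p v).2, congrArg Prod.snd hv⟩
  have key := degreeIn_eq_degreeIn_fixed L₁
    (Module.finBasis ℝ (ComplexSpace (k + 1))).equivFunL hK hPG hPe hP0
  rw [degreeIn_eq_zero_of_det _ hKK hPG hP0 hdet] at key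
  rw [key]
  refine degreeIn_eq_of_norm_sub_lt L₁ hK (F := fun x => (F (x, 0)).1)
    (F' := fun x => (P (G (x, 0))).1) (by fun_prop)
    (by have := hPG.continuous; fun_prop) fun x hx => ?_
  have hp := mem_frontier_prod_zero (k := k + 1) hx
  have h1 : ‖F (x, 0)‖ = ‖(F (x, 0)).1‖ := by
    rw [Prod.norm_def, hFe.snd_eq_zero x, norm_zero, max_eq_left (norm_nonneg _)]
  rw [← h1]
  exact (norm_fst_le (G (x, 0) - F (x, 0))).trans_lt (hGF' _ hp)

end FixedDegree

/-! ### Stereographic projection and radial extension of maps of spheres. -/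

/-- A continuous function that scales and grows like the square of the norm. -/
structure IsSquareNorm {V : Type*} [NormedAddCommGroup V] [NormedSpace ℝ V] (Q : V → ℝ) :
    Prop where
  continuous : Continuous Q
  smul : ∀ (a : ℝ) v, Q (a • v) = a ^ 2 * Q v
  norm_sq_le : ∀ v, ‖v‖ ^ 2 ≤ Q v

section Stereographic

variable {V W : Type*} [NormedAddCommGroup V] [NormedSpace ℝ V] [NormedAddCommGroup W]
  [NormedSpace ℝ W]

/-- Inverse stereographic projection. -/
noncomputable def toSphere (Q : V → ℝ) (p : OnePoint V) : V × ℝ :=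
  OnePoint.elim p (0, 1) fun v => ((2 / (Q v + 1)) • v, (Q v - 1) / (Q v + 1))

/-- The distance to the origin. -/
noncomputable def radius (Q : V → ℝ) (p : V × ℝ) : ℝ := √(Q p.1 + p.2 ^ 2)

open Classical in
/-- Stereographic projection, extended to rays. -/
noncomputable def fromSphere (Q : V → ℝ) (p : V × ℝ) : OnePoint V :=
  if p.2 = radius Q p then OnePoint.infty else (((radius Q p - p.2)⁻¹ • p.1 : V) : OnePoint V)

theorem toSphere_infty (Q : V → ℝ) : toSphere Q OnePoint.infty = (0, 1) := rfl

theorem toSphere_coe (Q : V → ℝ) (v : V) :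
    toSphere Q (v : OnePoint V) = ((2 / (Q v + 1)) • v, (Q v - 1) / (Q v + 1)) := rfl

variable {Q : V → ℝ} (hQ : IsSquareNorm Q)
include hQ

theorem IsSquareNorm.nonneg (v : V) : 0 ≤ Q v := (sq_nonneg _).trans (hQ.norm_sq_le v)

theorem IsSquareNorm.eq_zero {v : V} (h : Q v = 0) : v = 0 := by
  have := hQ.norm_sq_le v
  rw [h] at this
  exact norm_eq_zero.1 (by nlinarith [norm_nonneg v])

theorem sq_radius (p : V × ℝ) : radius Q p ^ 2 = Q p.1 + p.2 ^ 2 :=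
  Real.sq_sqrt (add_nonneg (hQ.nonneg _) (sq_nonneg _))

omit [NormedAddCommGroup V] [NormedSpace ℝ V] hQ in
theorem radius_nonneg (p : V × ℝ) : 0 ≤ radius Q p := Real.sqrt_nonneg _

theorem radius_pos {p : V × ℝ} (hp : p ≠ 0) : 0 < radius Q p := by
  refine lt_of_le_of_ne (radius_nonneg p) fun h => hp ?_
  have h1 := sq_radius hQ p
  rw [← h] at h1
  have h2 := hQ.nonneg p.1
  refine Prod.ext (hQ.eq_zero (by nlinarith)) (by simp; nlinarith)

theorem continuous_radius : Continuous (radius Q) := by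
  have := hQ.continuous
  unfold radius
  fun_prop

theorem radius_smul {a : ℝ} (ha : 0 ≤ a) (p : V × ℝ) : radius Q (a • p) = a * radius Q p := by
  rw [radius, radius, ← Real.sqrt_sq ha, ← Real.sqrt_mul (sq_nonneg _)]
  congr 1
  simp only [Prod.smul_fst, Prod.smul_snd, hQ.smul, smul_eq_mul, Real.sqrt_sq ha]
  ring

theorem radius_zero : radius Q (0 : V × ℝ) = 0 := by
  simpa using radius_smul hQ le_rfl (0 : V × ℝ)

theorem norm_le_radius (p : V × ℝ) : ‖p‖ ≤ radius Q p := by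
  have h1 := sq_radius hQ p
  have h2 := hQ.norm_sq_le p.1
  have h3 := hQ.nonneg p.1
  have h4 := radius_nonneg (Q := Q) p
  rw [Prod.norm_def, max_le_iff]
  refine ⟨abs_le_of_sq_le_sq' (by nlinarith) h4 |>.2, ?_⟩
  rw [Real.norm_eq_abs]
  exact abs_le_of_sq_le_sq (by nlinarith) h4

theorem snd_le_radius (p : V × ℝ) : p.2 ≤ radius Q p :=
  (le_abs_self _).trans ((norm_snd_le p).trans (norm_le_radius hQ p))

theorem radius_toSphere (p : OnePoint V) : radius Q (toSphere Q p) = 1 := by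
  have h0 : 0 ≤ radius Q (toSphere Q p) := radius_nonneg _
  have h1 : radius Q (toSphere Q p) ^ 2 = 1 := by
    rw [sq_radius hQ]
    induction p using OnePoint.rec with
    | infty =>
      have : Q 0 = 0 := by simpa using hQ.smul 0 0
      simp [toSphere_infty, this]
    | coe v =>
      have := hQ.nonneg v
      rw [toSphere_coe, hQ.smul]
      field_simp
      ring
  nlinarith

theorem fromSphere_toSphere (p : OnePoint V) : fromSphere Q (toSphere Q p) = p := by
  rw [fromSphere, radius_toSphere hQ]
  induction p using OnePoint.rec with
  | infty => simp [toSphere_infty]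
  | coe v =>
    have h := hQ.nonneg v
    have h1 : 0 < Q v + 1 := by linarith
    have h2 : 1 - (Q v - 1) / (Q v + 1) = 2 / (Q v + 1) := by field_simp; ring
    have h3 : (Q v - 1) / (Q v + 1) ≠ 1 := by
      rw [Ne, div_eq_one_iff_eq h1.ne']
      linarith
    rw [toSphere_coe, if_neg h3, h2, smul_smul, inv_mul_cancel₀ (by positivity), one_smul]

theorem toSphere_injective : Function.Injective (toSphere Q) :=
  Function.LeftInverse.injective (fromSphere_toSphere hQ)

/-- `fromSphere` is constant on rays, so the composite is radial projection. The key identity is `Q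
p.1 = (radius Q p - p.2) * (radius Q p + p.2)`. -/
theorem toSphere_fromSphere {p : V × ℝ} (hp : p ≠ 0) :
    toSphere Q (fromSphere Q p) = (radius Q p)⁻¹ • p := by
  have hN := radius_pos hQ hp
  have hsq := sq_radius hQ p
  rw [fromSphere]
  split_ifs with h
  · have h1 : p.1 = 0 := hQ.eq_zero (by rw [← h] at hsq; linarith)
    rw [toSphere_infty]
    refine Prod.ext (by simp [h1]) ?_
    rw [Prod.smul_snd, h, smul_eq_mul, inv_mul_cancel₀ hN.ne']
  · have h1 : 0 < radius Q p - p.2 := sub_pos.2 (lt_of_le_of_ne (snd_le_radius hQ p) h)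
    have h2 : Q ((radius Q p - p.2)⁻¹ • p.1) = (radius Q p + p.2) / (radius Q p - p.2) := by
      rw [hQ.smul, show Q p.1 = (radius Q p - p.2) * (radius Q p + p.2) by linarith]
      field_simp
    have h3 : (radius Q p + p.2) / (radius Q p - p.2) + 1 =
        2 * radius Q p / (radius Q p - p.2) := by
      field_simp
      ring
    rw [toSphere_coe, h2, h3, smul_smul]
    refine Prod.ext ?_ ?_
    · rw [Prod.smul_fst]
      field_simp
    · rw [Prod.smul_snd, smul_eq_mul]
      field_simp
      ring

theorem radius_smul_toSphere_fromSphere (p : V × ℝ) :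
    radius Q p • toSphere Q (fromSphere Q p) = p := by
  by_cases hp : p = 0
  · rw [hp, radius_zero hQ, zero_smul]
  · rw [toSphere_fromSphere hQ hp, smul_smul, mul_inv_cancel₀ (radius_pos hQ hp).ne', one_smul]

theorem fromSphere_smul_toSphere {a : ℝ} (ha : 0 < a) (p : OnePoint V) :
    fromSphere Q (a • toSphere Q p) = p := by
  have h1 : radius Q (a • toSphere Q p) = a := by
    rw [radius_smul hQ ha.le, radius_toSphere hQ, mul_one]
  have h2 : a • toSphere Q p ≠ 0 := fun h => by
    rw [h, radius_zero hQ] at h1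
    exact ha.ne h1
  apply toSphere_injective hQ
  rw [toSphere_fromSphere hQ h2, h1, smul_smul, inv_mul_cancel₀ ha.ne', one_smul]

theorem norm_toSphere_le (p : OnePoint V) : ‖toSphere Q p‖ ≤ 1 :=
  (norm_le_radius hQ _).trans (radius_toSphere hQ p).le

variable [FiniteDimensional ℝ V]

theorem continuous_toSphere : Continuous (toSphere Q) := by
  have hpos : ∀ v, Q v + 1 ≠ 0 := fun v => by linarith [hQ.nonneg v]
  have hc := hQ.continuous
  rw [OnePoint.continuous_iff]
  constructor
  · rw [Filter.coclosedCompact_eq_cocompact, toSphere_infty]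
    have hproper : ProperSpace V := FiniteDimensional.proper_real V
    have hn : Filter.Tendsto (fun v : V => ‖v‖) (Filter.cocompact V) Filter.atTop :=
      tendsto_norm_cocompact_atTop
    have hQt : Filter.Tendsto Q (Filter.cocompact V) Filter.atTop :=
      Filter.tendsto_atTop_mono hQ.norm_sq_le ((Filter.tendsto_pow_atTop two_ne_zero).comp hn)
    refine Filter.Tendsto.prodMk_nhds ?_ ?_
    · refine squeeze_zero_norm' (a := fun v : V => 2 * ‖v‖⁻¹) ?_
        (by simpa using (tendsto_inv_atTop_zero.comp hn).const_mul 2)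
      filter_upwards [hn.eventually_gt_atTop 0] with v hv
      have h1 := hQ.norm_sq_le v
      rw [norm_smul, Real.norm_of_nonneg (by have := hQ.nonneg v; positivity),
        div_mul_eq_mul_div, ← div_eq_mul_inv, div_le_div_iff₀ (by nlinarith) hv]
      nlinarith
    · have h1 : ∀ v : V, (Q v - 1) / (Q v + 1) = 1 - 2 * (Q v + 1)⁻¹ := fun v => by
        have := hpos v
        field_simp
        ring
      have h2 : Filter.Tendsto (fun v => 1 - 2 * (Q v + 1)⁻¹) (Filter.cocompact V)
          (𝓝 (1 - 2 * 0)) :=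
        ((tendsto_inv_atTop_zero.comp
          (Filter.tendsto_atTop_add_const_right _ 1 hQt)).const_mul 2).const_sub 1
      simpa only [h1, mul_zero, sub_zero] using h2
  · change Continuous fun v : V => toSphere Q (v : OnePoint V)
    simp only [toSphere_coe]
    fun_prop (disch := exact hpos)

theorem isClosedEmbedding_toSphere : Topology.IsClosedEmbedding (toSphere Q) :=
  (continuous_toSphere hQ).isClosedEmbedding (toSphere_injective hQ)

/-- As `toSphere` is an embedding, continuity can be tested after composing with it, where the case
distinction at infinity disappears. -/
theorem continuousOn_fromSphere : ContinuousOn (fromSphere Q) {0}ᶜ := by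
  rw [(isClosedEmbedding_toSphere hQ).isInducing.continuousOn_iff]
  have h1 : ContinuousOn (fun p : V × ℝ => (radius Q p)⁻¹ • p) {0}ᶜ := by
    refine ContinuousOn.smul (ContinuousOn.inv₀ (continuous_radius hQ).continuousOn
      fun p hp => (radius_pos hQ hp).ne') continuousOn_id
  exact h1.congr fun p hp => toSphere_fromSphere hQ hp

/-- The radial extension of a map between spheres. -/
noncomputable def radialExt (Q : V → ℝ) (Q' : W → ℝ) (f : OnePoint V → OnePoint W) (p : V × ℝ) :
    W × ℝ :=
  radius Q p • toSphere Q' (f (fromSphere Q p))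

variable {Q' : W → ℝ} (hQ' : IsSquareNorm Q')
include hQ'

omit [FiniteDimensional ℝ V] hQ in
theorem radius_radialExt (f : OnePoint V → OnePoint W) (p : V × ℝ) :
    radius Q' (radialExt Q Q' f p) = radius Q p := by
  rw [radialExt, radius_smul hQ' (radius_nonneg _), radius_toSphere hQ', mul_one]

omit [FiniteDimensional ℝ V] in
theorem radialExt_ne_zero (f : OnePoint V → OnePoint W) {p : V × ℝ} (hp : p ≠ 0) :
    radialExt Q Q' f p ≠ 0 := fun h => by
  have h1 := radius_radialExt hQ' (Q := Q) f p
  rw [h, radius_zero hQ'] at h1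
  exact (radius_pos hQ hp).ne h1

/-- The parameter `T` covers homotopies as well as single maps. At the origin, where `fromSphere` is
not continuous, the factor `radius Q` forces the limit. -/
theorem continuous_radialExt [FiniteDimensional ℝ W] {T : Type*} [TopologicalSpace T]
    {H : T × OnePoint V → OnePoint W} (hH : Continuous H) :
    Continuous fun x : T × (V × ℝ) => radialExt Q Q' (fun p => H (x.1, p)) x.2 := by
  rw [continuous_iff_continuousAt]
  rintro ⟨t, p⟩
  have hr := continuous_radius hQ
  by_cases hp : p = 0
  · subst hp
    rw [ContinuousAt]
    have h0 : radialExt Q Q' (fun p => H (t, p)) (0 : V × ℝ) = 0 := by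
      rw [radialExt, radius_zero hQ, zero_smul]
    rw [h0]
    refine squeeze_zero_norm (a := fun x : T × (V × ℝ) => radius Q x.2) (fun x => ?_) ?_
    · rw [radialExt, norm_smul, Real.norm_of_nonneg (radius_nonneg _)]
      exact mul_le_of_le_one_right (radius_nonneg _) (norm_toSphere_le hQ' _)
    · have : Continuous fun x : T × (V × ℝ) => radius Q x.2 := hr.comp continuous_snd
      simpa [radius_zero hQ] using this.tendsto (t, (0 : V × ℝ))
  · have h1 : ContinuousAt (fromSphere Q) p :=
      (continuousOn_fromSphere hQ).continuousAt (isOpen_compl_singleton.mem_nhds hp)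
    have h1' : ContinuousAt (fun x : T × (V × ℝ) => fromSphere Q x.2) (t, p) :=
      ContinuousAt.comp (g := fromSphere Q) (x := (t, p)) h1 continuousAt_snd
    have h2 : ContinuousAt (fun x : T × (V × ℝ) => (x.1, fromSphere Q x.2)) (t, p) :=
      continuousAt_fst.prodMk h1'
    have h3 : ContinuousAt (fun x : T × (V × ℝ) => toSphere Q' (H (x.1, fromSphere Q x.2)))
        (t, p) := ((continuous_toSphere hQ').comp hH).continuousAt.comp h2
    exact (hr.comp continuous_snd).continuousAt.smul h3

end Stereographic

theorem isSquareNorm_norm_sq (V : Type*) [NormedAddCommGroup V] [NormedSpace ℝ V] :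
    IsSquareNorm fun v : V => ‖v‖ ^ 2 where
  continuous := by fun_prop
  smul a v := by rw [norm_smul, mul_pow, Real.norm_eq_abs, sq_abs]
  norm_sq_le _ := le_rfl

/-- A continuous function without zeros on a connected space has constant sign. -/
theorem sign_eq_of_continuous {V : Type*} [TopologicalSpace V] [PreconnectedSpace V] {f : V → ℝ}
    (hf : Continuous f) (h0 : ∀ v, f v ≠ 0) (v w : V) :
    SignType.sign (f v) = SignType.sign (f w) := by
  rcases lt_or_gt_of_ne (h0 v) with hv | hv <;> rcases lt_or_gt_of_ne (h0 w) with hw | hw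
  · rw [sign_neg hv, sign_neg hw]
  · obtain ⟨u, hu⟩ := mem_range_of_exists_le_of_exists_ge hf ⟨v, hv.le⟩ ⟨w, hw.le⟩
    exact absurd hu (h0 u)
  · obtain ⟨u, hu⟩ := mem_range_of_exists_le_of_exists_ge hf ⟨w, hw.le⟩ ⟨v, hv.le⟩
    exact absurd hu (h0 u)
  · rw [sign_pos hv, sign_pos hw]

/-! ### Polar coordinates and the differential of a radial extension. -/

section Polar

variable (V : Type*) [NormedAddCommGroup V] [InnerProductSpace ℝ V]

/-- Polar coordinates on `V × ℝ`, with the stereographic chart on the sphere. -/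
noncomputable def polar (u : V × ℝ) : V × ℝ :=
  u.2 • ((2 / (‖u.1‖ ^ 2 + 1)) • u.1, (‖u.1‖ ^ 2 - 1) / (‖u.1‖ ^ 2 + 1))

variable {V}

theorem polar_eq (x : V) (t : ℝ) :
    polar V (x, t) = t • toSphere (fun v : V => ‖v‖ ^ 2) (x : OnePoint V) := rfl

theorem contDiff_polar : ContDiff ℝ ∞ (polar V) := by
  have h : ContDiff ℝ ∞ fun u : V × ℝ => ‖u.1‖ ^ 2 := (contDiff_norm_sq ℝ).comp contDiff_fst
  have h0 : ∀ u : V × ℝ, ‖u.1‖ ^ 2 + 1 ≠ 0 := fun u => by positivity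
  refine contDiff_snd.smul (ContDiff.prodMk ?_ ?_)
  · exact (contDiff_const.div (h.add contDiff_const) h0).smul contDiff_fst
  · exact (h.sub contDiff_const).div (h.add contDiff_const) h0

/-- The inverse of polar coordinates. -/
noncomputable def polarInv (p : V × ℝ) : V × ℝ :=
  ((radius (fun v : V => ‖v‖ ^ 2) p - p.2)⁻¹ • p.1, radius (fun v : V => ‖v‖ ^ 2) p)

theorem radius_polar {x : V} {t : ℝ} (ht : 0 ≤ t) :
    radius (fun v : V => ‖v‖ ^ 2) (polar V (x, t)) = t := by
  rw [polar_eq, radius_smul (isSquareNorm_norm_sq V) ht, radius_toSphere (isSquareNorm_norm_sq V),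
    mul_one]

theorem snd_polar_lt {x : V} {t : ℝ} (ht : 0 < t) : (polar V (x, t)).2 < t := by
  have h : 0 < ‖x‖ ^ 2 + 1 := by positivity
  have : (‖x‖ ^ 2 - 1) / (‖x‖ ^ 2 + 1) < 1 := by
    rw [div_lt_one h]
    linarith
  exact mul_lt_of_lt_one_right ht this

theorem polarInv_polar {x : V} {t : ℝ} (ht : 0 < t) : polarInv (polar V (x, t)) = (x, t) := by
  rw [polarInv, radius_polar ht.le]
  have h : 0 < ‖x‖ ^ 2 + 1 := by positivity
  have h1 : t - (polar V (x, t)).2 = t * (2 / (‖x‖ ^ 2 + 1)) := by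
    simp only [polar, Prod.smul_snd, smul_eq_mul]
    field_simp
    ring
  rw [h1]
  refine Prod.ext ?_ rfl
  simp only [polar, Prod.smul_fst, smul_smul]
  rw [inv_mul_cancel₀ (by positivity), one_smul]

theorem differentiableAt_polarInv {p : V × ℝ} (hp : p.2 < radius (fun v : V => ‖v‖ ^ 2) p) :
    DifferentiableAt ℝ polarInv p := by
  have h0 : p ≠ 0 := fun h => by
    rw [h, radius_zero (isSquareNorm_norm_sq V)] at hp
    exact lt_irrefl _ hp
  have hsq : ‖p.1‖ ^ 2 + p.2 ^ 2 ≠ 0 := by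
    rw [← sq_radius (isSquareNorm_norm_sq V) p]
    exact pow_ne_zero 2 (radius_pos (isSquareNorm_norm_sq V) h0).ne'
  have h1 : DifferentiableAt ℝ (fun p : V × ℝ => ‖p.1‖ ^ 2 + p.2 ^ 2) p := by
    have h : ContDiff ℝ ∞ fun u : V × ℝ => ‖u.1‖ ^ 2 := (contDiff_norm_sq ℝ).comp contDiff_fst
    have h' := (h.differentiable (by simp)).differentiableAt (x := p)
    fun_prop
  have h2 : DifferentiableAt ℝ (radius fun v : V => ‖v‖ ^ 2) p := h1.sqrt hsq
  have h3 : DifferentiableAt ℝ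
      (fun p : V × ℝ => (radius (fun v : V => ‖v‖ ^ 2) p - p.2)⁻¹) p :=
    (h2.sub differentiableAt_snd).inv (sub_pos.2 hp).ne'
  exact (h3.smul differentiableAt_fst).prodMk h2

theorem det_polar_mul_det_polarInv {x : V} {t : ℝ} (ht : 0 < t) :
    (fderiv ℝ polarInv (polar V (x, t))).det * (fderiv ℝ (polar V) (x, t)).det = 1 := by
  have h1 : HasFDerivAt (polar V) (fderiv ℝ (polar V) (x, t)) (x, t) :=
    ((contDiff_polar.differentiable (by simp)).differentiableAt).hasFDerivAt
  have h2 : HasFDerivAt polarInv (fderiv ℝ polarInv (polar V (x, t))) (polar V (x, t)) :=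
    (differentiableAt_polarInv (by rw [radius_polar ht.le]; exact snd_polar_lt ht)).hasFDerivAt
  have h3 := h2.comp (x, t) h1
  have h4 : (polarInv ∘ polar V) =ᶠ[𝓝 (x, t)] id := by
    filter_upwards [(isOpen_lt continuous_const continuous_snd).mem_nhds
      (show (0 : ℝ) < ((x, t) : V × ℝ).2 from ht)] with u hu
    exact polarInv_polar (x := u.1) (t := u.2) hu
  have h5 := h3.unique ((hasFDerivAt_id (x, t)).congr_of_eventuallyEq h4)
  have h6 := congrArg (fun A : V × ℝ →L[ℝ] V × ℝ => LinearMap.det (A : V × ℝ →ₗ[ℝ] V × ℝ)) h5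
  simp only [ContinuousLinearMap.toLinearMap_comp, LinearMap.det_comp,
    ContinuousLinearMap.coe_id, LinearMap.det_id] at h6
  exact h6

/-- The determinant never vanishes and `V` is connected. Whether polar coordinates preserve
orientation is immaterial: only constancy matters, since source and target signs cancel. -/
theorem sign_det_polar [FiniteDimensional ℝ V] {t : ℝ} (ht : 0 < t) (x y : V) :
    SignType.sign (fderiv ℝ (polar V) (x, t)).det =
      SignType.sign (fderiv ℝ (polar V) (y, t)).det := by
  refine sign_eq_of_continuous (f := fun x => (fderiv ℝ (polar V) (x, t)).det) ?_ ?_ x y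
  · exact ContinuousLinearMap.continuous_det.comp
      ((contDiff_polar.continuous_fderiv (by simp)).comp (by fun_prop))
  · intro x h
    have := det_polar_mul_det_polarInv (x := x) ht
    rw [h, mul_zero] at this
    exact zero_ne_one this

/-- The differential of a radial extension at a preimage of a point. -/
theorem hasFDerivAt_radialExt [FiniteDimensional ℝ V] {g : OnePoint V → OnePoint V} {φ : V → V}
    {x : V} {D : V →L[ℝ] V} (hφ : HasFDerivAt φ D x) (hD : D.det ≠ 0)
    (hg : ∀ᶠ z : V in 𝓝 x, g (z : OnePoint V) = (φ z : OnePoint V)) {t : ℝ} (ht : 0 < t) :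
    ∃ A : V × ℝ →L[ℝ] V × ℝ,
      HasFDerivAt (radialExt (fun v : V => ‖v‖ ^ 2) (fun v : V => ‖v‖ ^ 2) g) A (polar V (x, t)) ∧
      A.det ≠ 0 ∧ SignType.sign A.det = SignType.sign D.det := by
  have hlt : (polar V (x, t)).2 < radius (fun v : V => ‖v‖ ^ 2) (polar V (x, t)) := by
    rw [radius_polar ht.le]
    exact snd_polar_lt ht
  have h1 : HasFDerivAt polarInv (fderiv ℝ polarInv (polar V (x, t))) (polar V (x, t)) :=
    (differentiableAt_polarInv hlt).hasFDerivAt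
  have h2 : HasFDerivAt (Prod.map φ id) (D.prodMap (ContinuousLinearMap.id ℝ ℝ))
      (polarInv (polar V (x, t))) := by
    rw [polarInv_polar ht]
    exact HasFDerivAt.prodMap (x, t) hφ (hasFDerivAt_id t)
  have h3 : HasFDerivAt (polar V) (fderiv ℝ (polar V) (φ x, t))
      (Prod.map φ id (polarInv (polar V (x, t)))) := by
    rw [polarInv_polar ht]
    exact ((contDiff_polar.differentiable (by simp)).differentiableAt).hasFDerivAt
  -- In polar coordinates on both sides the radial extension is `φ × id`.
  have h4 := h3.comp (polar V (x, t)) (h2.comp (polar V (x, t)) h1)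
  have hdet : ((fderiv ℝ (polar V) (φ x, t)).comp ((D.prodMap (ContinuousLinearMap.id ℝ ℝ)).comp
      (fderiv ℝ polarInv (polar V (x, t))))).det =
      (fderiv ℝ (polar V) (φ x, t)).det * (D.det * (fderiv ℝ polarInv (polar V (x, t))).det) := by
    have hp : LinearMap.det ((D : V →ₗ[ℝ] V).prodMap (LinearMap.id (R := ℝ) (M := ℝ))) =
        LinearMap.det (D : V →ₗ[ℝ] V) := by
      rw [LinearMap.det_prodMap, LinearMap.det_id, mul_one]
    simp only [ContinuousLinearMap.det]
    rw [← hp, ← LinearMap.det_comp, ← LinearMap.det_comp]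
    rfl
  have hx := det_polar_mul_det_polarInv (x := x) ht
  have hy := det_polar_mul_det_polarInv (x := φ x) ht
  refine ⟨_, h4.congr_of_eventuallyEq ?_, ?_, ?_⟩
  · have hc : ContinuousAt (fun p : V × ℝ => (polarInv p).1) (polar V (x, t)) :=
      (h1.continuousAt).fst
    have hg' : ∀ᶠ z : V in 𝓝 (polarInv (polar V (x, t))).1,
        g (z : OnePoint V) = (φ z : OnePoint V) := by
      rw [polarInv_polar ht]
      exact hg
    have hrad := continuous_radius (isSquareNorm_norm_sq V)
    filter_upwards [hc.eventually hg', (isOpen_lt continuous_snd hrad).mem_nhds hlt] with p hp hp2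
    replace hp2 : p.2 < radius (fun v : V => ‖v‖ ^ 2) p := hp2
    rw [radialExt, fromSphere, if_neg hp2.ne]
    change radius (fun v : V => ‖v‖ ^ 2) p • toSphere _ (g ((polarInv p).1 : V)) = _
    rw [hp]
    rfl
  · rw [hdet]
    exact mul_ne_zero (right_ne_zero_of_mul (hy.trans_ne one_ne_zero))
      (mul_ne_zero hD (left_ne_zero_of_mul (hx.trans_ne one_ne_zero)))
  · rw [hdet, sign_mul, sign_mul, sign_det_polar ht (φ x) x, mul_left_comm, ← sign_mul,
      mul_comm (fderiv ℝ (polar V) (x, t)).det, hx]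
    simp

end Polar

/-! ### The degree of a radial extension is the Brouwer degree. -/

section

variable {V : Type*} [NormedAddCommGroup V] [InnerProductSpace ℝ V] [FiniteDimensional ℝ V]
  {ι : Type*} [Fintype ι] (L : (V × ℝ) ≃L[ℝ] (ι → ℝ))

local notation "sq" => fun v : V => ‖v‖ ^ 2

omit [FiniteDimensional ℝ V] in
theorem ne_zero_of_mem_frontier_closedBall {E : Type*} [NormedAddCommGroup E] {p : E}
    (hp : p ∈ frontier (Metric.closedBall (0 : E) 1)) : p ≠ 0 := by
  rintro rfl
  rw [Metric.isClosed_closedBall.frontier_eq] at hp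
  exact hp.2 (Metric.ball_subset_interior_closedBall (Metric.mem_ball_self one_pos))

theorem degreeIn_radialExt_of_homotopic {g g' : C(OnePoint V, OnePoint V)}
    (h : ContinuousMap.Homotopic g g') :
    degreeIn L (Metric.closedBall 0 1) (radialExt sq sq g) =
      degreeIn L (Metric.closedBall 0 1) (radialExt sq sq g') := by
  obtain ⟨H⟩ := h
  have := degreeIn_homotopy L (isCompact_closedBall (0 : V × ℝ) 1)
    (H := fun t => radialExt sq sq fun p => H (t, p))
    (continuous_radialExt (isSquareNorm_norm_sq V) (isSquareNorm_norm_sq V) H.continuous)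
    (fun t x hx => radialExt_ne_zero (isSquareNorm_norm_sq V) (isSquareNorm_norm_sq V) _
      (ne_zero_of_mem_frontier_closedBall hx))
  simpa using this

theorem degreeIn_radialExt_id :
    degreeIn L (Metric.closedBall 0 1) (radialExt sq sq id) = 1 := by
  have hid : radialExt sq sq id = id :=
    funext fun p => radius_smul_toSphere_fromSphere (isSquareNorm_norm_sq V) p
  rw [hid, degreeIn_eq_sum_sign L (isCompact_closedBall _ _) continuous_id {0} (by simp) (by simp)
    (by simpa using Metric.ball_subset_interior_closedBall (Metric.mem_ball_self one_pos))
    (fun _ => ContinuousLinearMap.id ℝ _) (fun x _ => hasFDerivAt_id x)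
    (by simp [ContinuousLinearMap.det])]
  simp [ContinuousLinearMap.det]

/-- The degree of the radial extension is the signed count of the preimages of a regular value. -/
theorem degreeIn_radialExt_eq_sum {g : C(OnePoint V, OnePoint V)} {φ : V → V} {y : V}
    (hφ : ∀ x : V, g x = y → ∀ᶠ z : V in 𝓝 x, g (z : OnePoint V) = (φ z : OnePoint V))
    (hinf : g OnePoint.infty ≠ y) (s : Finset V) (hs : ∀ x : V, x ∈ s ↔ g x = y)
    (hd : ∀ x ∈ s, DifferentiableAt ℝ φ x) (hdet : ∀ x ∈ s, (fderiv ℝ φ x).det ≠ 0) :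
    degreeIn L (Metric.closedBall 0 1) (radialExt sq sq g) =
      ∑ x ∈ s, (SignType.sign (fderiv ℝ φ x).det : ℝ) := by
  classical
  have hQ := isSquareNorm_norm_sq V
  have hK := isCompact_closedBall (0 : V × ℝ) 1
  set F := radialExt sq sq g with hF
  have hFc : Continuous F :=
    (continuous_radialExt (T := Unit) hQ hQ (H := fun p => g p.2)
      (g.continuous.comp continuous_snd)).comp (f := fun p => ((), p)) (by fun_prop)
  obtain ⟨m, hm, hmF⟩ := (isCompact_frontier hK).exists_forall_le' hFc.norm.continuousOn
    (a := 0) fun p hp => norm_pos_iff.2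
      (radialExt_ne_zero hQ hQ _ (ne_zero_of_mem_frontier_closedBall hp))
  set ε : ℝ := min (m / 2) (1 / 2) with hε
  have hε0 : 0 < ε := by positivity
  have hεm : ε < m := (min_le_left _ _).trans_lt (half_lt_self hm)
  have hε1 : ε < 1 := (min_le_right _ _).trans_lt (by norm_num)
  -- The origin is a degenerate zero of the cone, so the value is moved to the small point `q` on
  -- the ray over `y`. Its preimages are the points of radius `ε` over `s`; `ε < m` preserves the
  -- degree and `ε < 1` puts them inside the ball.
  set q : V × ℝ := ε • toSphere sq (y : OnePoint V) with hq
  have hqn : ‖q‖ ≤ ε := by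
    rw [hq, norm_smul, Real.norm_of_nonneg hε0.le]
    exact mul_le_of_le_one_right hε0.le (norm_toSphere_le hQ _)
  set F' : V × ℝ → V × ℝ := fun p => F p - q with hF'
  have hF'c : Continuous F' := hFc.sub continuous_const
  have hstep : degreeIn L (Metric.closedBall 0 1) F = degreeIn L (Metric.closedBall 0 1) F' := by
    refine degreeIn_eq_of_norm_sub_lt L hK hFc hF'c fun p hp => ?_
    have : F' p - F p = -q := by simp [hF']
    rw [this, norm_neg]
    exact (hqn.trans_lt hεm).trans_le (hmF p hp)
  have hzero : ∀ p, F' p = 0 ↔ ∃ x ∈ s, polar V (x, ε) = p := by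
    intro p
    rw [hF', sub_eq_zero]
    constructor
    · intro h
      have hr : radius sq p = ε := by
        rw [← radius_radialExt hQ g p, ← hF, h, hq, radius_smul hQ hε0.le, radius_toSphere hQ,
          mul_one]
      have h1 : g (fromSphere sq p) = y := by
        apply toSphere_injective hQ
        refine smul_right_injective _ hε0.ne' ?_
        simp only
        rw [← hq, ← h, hF, radialExt, hr]
      have h2 := radius_smul_toSphere_fromSphere hQ p
      generalize fromSphere sq p = x at h1 h2
      induction x using OnePoint.rec with
      | infty => exact absurd h1 hinf
      | coe x =>
        refine ⟨x, (hs x).2 h1, ?_⟩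
        rw [polar_eq, ← hr]
        exact h2
    · rintro ⟨x, hx, rfl⟩
      rw [hF, radialExt, radius_polar hε0.le, polar_eq, fromSphere_smul_toSphere hQ hε0,
        (hs x).1 hx]
  have hinj : Set.InjOn (fun x => polar V (x, ε)) s := fun x _ x' _ h => by
    have h2 := congrArg polarInv h
    simp only [polarInv_polar hε0] at h2
    exact congrArg Prod.fst h2
  have hder : ∀ x ∈ s, ∃ A : V × ℝ →L[ℝ] V × ℝ, HasFDerivAt F' A (polar V (x, ε)) ∧ A.det ≠ 0 ∧
      SignType.sign A.det = SignType.sign (fderiv ℝ φ x).det := fun x hx => by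
    obtain ⟨A, hA, h1, h2⟩ := hasFDerivAt_radialExt (hd x hx).hasFDerivAt (hdet x hx)
      (hφ x ((hs x).1 hx)) hε0
    exact ⟨A, hA.sub_const q, h1, h2⟩
  rw [hstep, degreeIn_eq_sum_sign L hK hF'c (s.image fun x => polar V (x, ε))
    (fun p _ hp => by simpa using (hzero p).1 hp) (fun p hp => (hzero p).2 (by simpa using hp))
    ?_ (fderiv ℝ F') ?_ ?_]
  · rw [Finset.sum_image hinj]
    refine Finset.sum_congr rfl fun x hx => ?_
    obtain ⟨A, hA, -, h2⟩ := hder x hx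
    rw [hA.fderiv, h2]
  · intro p hp
    obtain ⟨x, hx, rfl⟩ := Finset.mem_image.1 hp
    refine Metric.ball_subset_interior_closedBall (mem_ball_zero_iff.2 ?_)
    refine (norm_le_radius hQ _).trans_lt ?_
    rw [radius_polar hε0.le]
    exact hε1
  · intro p hp
    obtain ⟨x, hx, rfl⟩ := Finset.mem_image.1 hp
    obtain ⟨A, hA, -, -⟩ := hder x hx
    exact hA.differentiableAt.hasFDerivAt
  · intro p hp
    obtain ⟨x, hx, rfl⟩ := Finset.mem_image.1 hp
    obtain ⟨A, hA, h1, -⟩ := hder x hx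
    rw [hA.fderiv]
    exact h1

end

/-- By continuity `g` stays finite near a point with finite value, so the default value of
`chartMap` plays no role there. -/
theorem eventually_coe_chartMap {m : ℕ} (g : C(RealSphere m, RealSphere m)) {x y : RealSpace m}
    (h : g x = y) :
    ∀ᶠ z : RealSpace m in 𝓝 x, g (z : RealSphere m) = (chartMap g z : RealSphere m) := by
  have hc : ContinuousAt (fun z : RealSpace m => g (z : RealSphere m)) x :=
    (g.continuous.comp OnePoint.continuous_coe).continuousAt
  filter_upwards [hc.eventually_ne (h.trans_ne (OnePoint.coe_ne_infty y))] with z hz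
  obtain ⟨w, hw⟩ := OnePoint.ne_infty_iff_exists.1 hz
  rw [chartMap, ← hw]
  rfl

theorem eq_id_of_hasDegree_zero {g : C(RealSphere 0, RealSphere 0)} (h : HasDegree g 1) :
    (g : RealSphere 0 → RealSphere 0) = id := by
  have h1 : (1 : ℤ) = _ := h
  split_ifs at h1 with h2 h3 h3
  · simp at h1
  · funext p
    induction p using OnePoint.rec with
    | infty =>
      by_contra hne
      obtain ⟨w, hw⟩ := OnePoint.ne_infty_iff_exists.1 hne
      rw [Subsingleton.elim w 0] at hw
      exact h3 hw.symm
    | coe x => rw [Subsingleton.elim x 0, h2, id]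
  · simp at h1
  · simp at h1

theorem degreeIn_radialExt_of_hasDegree {ι : Type*} [Fintype ι] {m : ℕ}
    (L : (RealSpace m × ℝ) ≃L[ℝ] (ι → ℝ)) {g : C(RealSphere m, RealSphere m)}
    (h : HasDegree g 1) :
    degreeIn L (Metric.closedBall 0 1)
      (radialExt (fun v : RealSpace m => ‖v‖ ^ 2) (fun v : RealSpace m => ‖v‖ ^ 2) g) = 1 := by
  cases m with
  | zero => rw [eq_id_of_hasDegree_zero h, degreeIn_radialExt_id]
  | succ m =>
    obtain ⟨g', hgg', y, ⟨hinf, hreg⟩, s, hs, ha⟩ := h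
    rw [degreeIn_radialExt_of_homotopic L hgg', degreeIn_radialExt_eq_sum L (φ := chartMap g')
      (fun x hx => eventually_coe_chartMap g' hx) hinf s hs
      (fun x hx => (hreg x ((hs x).1 hx)).1.differentiableAt (by simp))
      (fun x hx => (hreg x ((hs x).1 hx)).2)]
    have := congrArg (fun a : ℤ => (a : ℝ)) ha
    simpa using this.symm

/-! ### The equivariant cone of a map of representation spheres. -/

section Equivariant

variable (m k : ℕ)

/-- The square of the Euclidean norm of `ℝ^m ⊕ ℂ^k`. -/
noncomputable def repSq (v : RepSpace m k) : ℝ := ‖v.1‖ ^ 2 + ‖v.2‖ ^ 2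

/-- The product norm on `RepSpace` is a maximum, not Euclidean. Using the Euclidean square through
`IsSquareNorm` instead avoids changing the type and still restricts to `‖v‖ ^ 2` on the fixed part.
-/
theorem isSquareNorm_repSq : IsSquareNorm (repSq m k) where
  continuous := by unfold repSq; fun_prop
  smul a v := by
    simp only [repSq, Prod.smul_fst, Prod.smul_snd, norm_smul, mul_pow, Real.norm_eq_abs, sq_abs]
    ring
  norm_sq_le v := by
    rw [repSq, Prod.norm_def]
    rcases max_choice ‖v.1‖ ‖v.2‖ with h | h <;> rw [h] <;>
      nlinarith [sq_nonneg ‖v.1‖, sq_nonneg ‖v.2‖]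

variable {m k}

theorem repSq_circleRot (q : Circle) (v : RepSpace m k) :
    repSq m k (circleRot q v) = repSq m k v := by
  simp only [repSq, circleRot, norm_smul, Circle.norm_coe, one_mul]

theorem toSphere_smul (q : Circle) (p : RepSphere m k) :
    toSphere (repSq m k) (q • p) =
      (circleRot q (toSphere (repSq m k) p).1, (toSphere (repSq m k) p).2) := by
  induction p using OnePoint.rec with
  | infty =>
    rw [circle_smul_infty, toSphere_infty]
    refine Prod.ext (Prod.ext rfl ?_) rfl
    exact (smul_zero (q : ℂ)).symm
  | coe v =>
    rw [circle_smul_coe, toSphere_coe, toSphere_coe, repSq_circleRot]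
    refine Prod.ext (Prod.ext rfl ?_) rfl
    exact (smul_comm (q : ℂ) (2 / (repSq m k v + 1)) v.2).symm

theorem fromSphere_circleRot (q : Circle) (v : RepSpace m k) (s : ℝ) :
    fromSphere (repSq m k) (circleRot q v, s) = q • fromSphere (repSq m k) (v, s) := by
  have hr : radius (repSq m k) (circleRot q v, s) = radius (repSq m k) (v, s) := by
    simp only [radius, repSq_circleRot]
  rw [fromSphere, fromSphere, hr]
  split_ifs
  · rfl
  · rw [circle_smul_coe]
    congr 1
    refine Prod.ext rfl ?_
    exact smul_comm _ (q : ℂ) v.2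

theorem toSphere_realIncl (p : RealSphere m) :
    toSphere (repSq m k) (realIncl m k p) =
      (((toSphere (fun v : RealSpace m => ‖v‖ ^ 2) p).1, 0),
        (toSphere (fun v : RealSpace m => ‖v‖ ^ 2) p).2) := by
  induction p using OnePoint.rec with
  | infty => rfl
  | coe v =>
    change toSphere (repSq m k) (((v, 0) : RepSpace m k) : RepSphere m k) = _
    rw [toSphere_coe, toSphere_coe]
    have : repSq m k (v, 0) = ‖v‖ ^ 2 := by simp [repSq]
    rw [this]
    refine Prod.ext (Prod.ext rfl ?_) rfl
    exact smul_zero _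

theorem radius_zero_right (x : RealSpace m) (s : ℝ) :
    radius (repSq m k) ((x, 0), s) = radius (fun v : RealSpace m => ‖v‖ ^ 2) (x, s) := by
  simp [radius, repSq]

theorem fromSphere_zero_right (x : RealSpace m) (s : ℝ) :
    fromSphere (repSq m k) ((x, 0), s) =
      realIncl m k (fromSphere (fun v : RealSpace m => ‖v‖ ^ 2) (x, s)) := by
  rw [fromSphere, fromSphere, radius_zero_right]
  split_ifs
  · rfl
  · change _ = ((_ : RepSpace m k) : RepSphere m k)
    congr 1
    exact Prod.ext rfl (smul_zero _)

/-- The radial extension of a map of representation spheres, with the coordinates in the order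
fixed part, free part. -/
noncomputable def repExt {n : ℕ} (f : C(RepSphere m k, RepSphere m n))
    (p : (RealSpace m × ℝ) × ComplexSpace k) : (RealSpace m × ℝ) × ComplexSpace n :=
  let w := radialExt (repSq m k) (repSq m n) f ((p.1.1, p.2), p.1.2)
  ((w.1.1, w.2), w.1.2)

theorem continuous_repExt {n : ℕ} (f : C(RepSphere m k, RepSphere m n)) :
    Continuous (repExt f) := by
  have h : Continuous (radialExt (repSq m k) (repSq m n) f) :=
    (continuous_radialExt (T := Unit) (isSquareNorm_repSq m k) (isSquareNorm_repSq m n)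
      (H := fun p => f p.2) (f.continuous.comp continuous_snd)).comp (f := fun p => ((), p))
        (by fun_prop)
  unfold repExt
  fun_prop

theorem repExt_ne_zero {n : ℕ} (f : C(RepSphere m k, RepSphere m n))
    {p : (RealSpace m × ℝ) × ComplexSpace k} (hp : p ≠ 0) : repExt f p ≠ 0 := by
  intro h
  refine radialExt_ne_zero (isSquareNorm_repSq m k) (isSquareNorm_repSq m n) f
    (p := ((p.1.1, p.2), p.1.2)) (fun h0 => hp ?_) ?_
  · exact Prod.ext (Prod.ext (congrArg (fun u => u.1.1) h0) (congrArg (fun u => u.2) h0))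
      (congrArg (fun u => u.1.2) h0)
  · exact Prod.ext (Prod.ext (congrArg (fun u => u.1.1) h) (congrArg (fun u => u.2) h))
      (congrArg (fun u => u.1.2) h)

theorem isEquivariant_repExt {n : ℕ} (f : C(RepSphere m k, RepSphere m n))
    (hf : ∀ (q : Circle) (p : RepSphere m k), f (q • p) = q • f p) :
    IsEquivariant (repExt f) := by
  rintro q ⟨x, s⟩ z
  have hr : radius (repSq m k) (circleRot q (x, z), s) = radius (repSq m k) ((x, z), s) := by
    simp only [radius, repSq_circleRot]
  have h : radialExt (repSq m k) (repSq m n) f (circleRot q (x, z), s) =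
      (circleRot q (radialExt (repSq m k) (repSq m n) f ((x, z), s)).1,
        (radialExt (repSq m k) (repSq m n) f ((x, z), s)).2) := by
    rw [radialExt, hr, fromSphere_circleRot, hf, toSphere_smul]
    refine Prod.ext (Prod.ext rfl ?_) rfl
    exact smul_comm _ (q : ℂ) _
  change ((_, _), _) = _
  rw [show (((x, s), (q : ℂ) • z).1.1, ((x, s), (q : ℂ) • z).2) = circleRot q (x, z) from rfl]
  dsimp only
  rw [h]
  rfl

theorem repExt_fst {n : ℕ} (f : C(RepSphere m k, RepSphere m n))
    (hf : ∀ (q : Circle) (p : RepSphere m k), f (q • p) = q • f p) (p : RealSpace m × ℝ) :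
    (repExt f (p, 0)).1 = radialExt (fun v : RealSpace m => ‖v‖ ^ 2)
      (fun v : RealSpace m => ‖v‖ ^ 2) (fixedSphereMap f hf) p := by
  obtain ⟨x, s⟩ := p
  have h : radialExt (repSq m k) (repSq m n) f ((x, 0), s) =
      (((radialExt (fun v : RealSpace m => ‖v‖ ^ 2) (fun v : RealSpace m => ‖v‖ ^ 2)
        (fixedSphereMap f hf) (x, s)).1, 0),
      (radialExt (fun v : RealSpace m => ‖v‖ ^ 2) (fun v : RealSpace m => ‖v‖ ^ 2)
        (fixedSphereMap f hf) (x, s)).2) := by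
    rw [radialExt, radius_zero_right, fromSphere_zero_right, ← realIncl_fixedSphereMap f hf,
      toSphere_realIncl]
    refine Prod.ext (Prod.ext rfl ?_) rfl
    exact smul_zero _
  simp only [repExt]
  rw [h]

end Equivariant

end BrouwerDegree

/-! ### Conclusion: the fixed part would have degree both `0` and `1`. -/

theorem mainTheorem9 (m n k : ℕ) (d : ℤ) (hk : (k : ℤ) = (n : ℤ) + d)
    (f : C(RepSphere m k, RepSphere m n))
    (hf : ∀ (q : Circle) (p : RepSphere m k), f (q • p) = q • f p)
    (hdeg : HasDegree (fixedSphereMap f hf) 1) :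
    d ≤ 0 := by
  by_contra! hd
  obtain ⟨l, rfl⟩ : ∃ l, k = l + 1 := ⟨k - 1, by omega⟩
  have h1 := BrouwerDegree.degreeIn_fixed_eq_zero (n := n) (k := l) (by omega)
    (Module.finBasis ℝ (RealSpace m × ℝ)).equivFunL (isCompact_closedBall 0 1)
    (BrouwerDegree.continuous_repExt f) (BrouwerDegree.isEquivariant_repExt f hf)
    (fun p hp => BrouwerDegree.repExt_ne_zero f (by
      -- For the maximum norm the product of the two unit balls is the unit ball, so its frontier
      -- avoids the origin, the only zero of the cone.
      rw [closedBall_prod_same] at hp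
      exact BrouwerDegree.ne_zero_of_mem_frontier_closedBall hp))
  simp only [BrouwerDegree.repExt_fst f hf] at h1
  exact one_ne_zero ((BrouwerDegree.degreeIn_radialExt_of_hasDegree _ hdeg).symm.trans h1)
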